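/- Consider light reflecting in the semi-infinite cylinder $C=\{(x,y,z)\in\mathbb{R}^3: y^2+z^2=1,\ x\le 0\}$ with opening $\partial_rC=\{(x,y,z)\in\mathbb{R}^3: y^2+z^2\le 1,\ x=0\}$. Let $(\Theta_k)_{k\ge1}$ and $(\Phi_k)_{k\ge1}$ be random variables, all jointly independent, such that each $\Theta_k$ has density $\frac12\cos\theta$ on $(-\pi/2,\pi/2)$ and each $\Phi_k$ is uniform on $[-\pi/2,\pi/2]$. Put $$R_k=\frac{2\cos\Theta_k}{\sin^2\Phi_k\sin^2\Theta_k+\cos^2\Theta_k},$$ $S_0=(0,0,-1)$ and, for $k\ge1$, define $S_k=(S^x_k,S^y_k,S^z_k)$ by \begin{align*} S^x_k&=S^x_{k-1}+R_k\cos\Phi_k\sin\Theta_k,\\ S^y_k&=S^y_{k-1}+R_k\,(-S^z_{k-1}\sin\Phi_k\sin\Theta_k-S^y_{k-1}\cos\Theta_k),\\ S^z_k&=S^z_{k-1}+R_k\,(S^y_{k-1}\sin\Phi_k\sin\Theta_k-S^z_{k-1}\cos\Theta_k). \end{align*} The reflection points of the ray started at $(-s,0,-1)$ are $S_k+(-s,0,0)$.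 For $s\ge0$ let $$N_s=\inf\{n>0:S^x_n>s\},\qquad O_s=S^x_{N_s}-s,\qquad U_s=s-S^x_{N_s-1},$$ and let $Y_s\in\partial_rC$ be the point at which the ray exits, i.e., with $\lambda_s=(s-S^x_{N_s-1})/(S^x_{N_s}-S^x_{N_s-1})$, $$Y_s=\bigl(0,\ \lambda_s(S^y_{N_s}-S^y_{N_s-1})+S^y_{N_s-1},\ \lambda_s(S^z_{N_s}-S^z_{N_s-1})+S^z_{N_s-1}\bigr).$$ For $t\in[0,1]$ let $$\Gamma(t)=\frac{\mathbb{E}\bigl[(t(U_0+O_0)-U_0)^+\bigr]}{\mathbb{E}[O_0]},$$ and let $B_r(0)=\{(x,y,z)\in\partial_rC: y^2+z^2\le r^2\}$. Then $N_s<\infty$ almost surely for every $s\ge 0$, the expectations defining $\Gamma$ are finite, $\mathbb{E}[O_0]>0$, and for every $r\in(0,1)$ the limit $\lim_{s\to\infty}\mathbb{P}(Y_s\in B_r(0))$ exists and satisfies $$\lim_{s\to\infty}\mathbb{P}(Y_s\in B_r(0))\le \Gamma\Bigl(\frac{1+r}{2}\Bigr)-\Gamma\Bigl(\frac{1-r}{2}\Bigr)$$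 and $$\lim_{s\to\infty}\mathbb{P}(Y_s\in B_r(0))\le a(r):=\Bigl(\tfrac12+\pi^{-1/2}-2\pi^{-3/2}\Bigr)r+\tfrac12-\pi^{-1/2}+2\pi^{-3/2}.$$ -/

import Mathlib

open MeasureTheory ProbabilityTheory Filter Topology

namespace CylinderLight

noncomputable section

/-- The Lambertian law of the reflection angle: density `cos θ / 2` on `(-π/2, π/2)`. -/
def lambertianLaw : Measure ℝ :=
  volume.withDensity fun θ =>
    ENNReal.ofReal ((Set.Ioo (-(Real.pi / 2)) (Real.pi / 2)).indicator (fun x => Real.cos x / 2) θ)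

/-- The distance to the next reflection point when the outgoing ray makes the angle `θ` with the
normal and its projection to the tangent plane makes the angle `φ` with the axis direction. -/
def chordLength (θ φ : ℝ) : ℝ :=
  2 * Real.cos θ / (Real.sin φ ^ 2 * Real.sin θ ^ 2 + Real.cos θ ^ 2)

/-- The next reflection point, from the reflection point `p = (x, y, z)` on `y² + z² = 1`. -/
def nextPoint (θ φ : ℝ) (p : ℝ × ℝ × ℝ) : ℝ × ℝ × ℝ :=
  (p.1 + chordLength θ φ * (Real.cos φ * Real.sin θ),
   p.2.1 + chordLength θ φ * (-p.2.2 * Real.sin φ * Real.sin θ - p.2.1 * Real.cos θ),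
   p.2.2 + chordLength θ φ * (p.2.1 * Real.sin φ * Real.sin θ - p.2.2 * Real.cos θ))

variable {Ω : Type*}

/-- The walk `S_k = (S^x_k, S^y_k, S^z_k)` of reflection points, started at `(0, 0, -1)`.
The light source is at `(-s, 0, -1)`, so the `k`-th reflection point is
`(S^x_k - s, S^y_k, S^z_k)`. The angles of the step from `S_k` to `S_{k+1}` are
`Θ k` and `Φ k`. -/
def walk (Θ Φ : ℕ → Ω → ℝ) : ℕ → Ω → ℝ × ℝ × ℝ
  | 0, _ => (0, 0, -1)
  | k + 1, ω => nextPoint (Θ k ω) (Φ k ω) (walk Θ Φ k ω)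

/-- The axial coordinate `S^x_k`. -/
def walkX (Θ Φ : ℕ → Ω → ℝ) (k : ℕ) (ω : Ω) : ℝ := (walk Θ Φ k ω).1

/-- The coordinate `S^y_k`. -/
def walkY (Θ Φ : ℕ → Ω → ℝ) (k : ℕ) (ω : Ω) : ℝ := (walk Θ Φ k ω).2.1

/-- The coordinate `S^z_k`. -/
def walkZ (Θ Φ : ℕ → Ω → ℝ) (k : ℕ) (ω : Ω) : ℝ := (walk Θ Φ k ω).2.2

/-- `N_s = inf {n > 0 : S^x_n > s}` (with the value `0` if there is no such `n`). -/
def passageTime (Θ Φ : ℕ → Ω → ℝ) (s : ℝ) (ω : Ω) : ℕ :=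
  sInf {n : ℕ | 0 < n ∧ s < walkX Θ Φ n ω}

/-- The overshoot `O_s = S^x_{N_s} - s`. -/
def overshoot (Θ Φ : ℕ → Ω → ℝ) (s : ℝ) (ω : Ω) : ℝ :=
  walkX Θ Φ (passageTime Θ Φ s ω) ω - s

/-- The undershoot `U_s = s - S^x_{N_s - 1}`. -/
def undershoot (Θ Φ : ℕ → Ω → ℝ) (s : ℝ) (ω : Ω) : ℝ :=
  s - walkX Θ Φ (passageTime Θ Φ s ω - 1) ω

/-- The fraction of the last chord, between reflections `N_s - 1` and `N_s`,
which lies inside the cylinder. -/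
def exitFraction (Θ Φ : ℕ → Ω → ℝ) (s : ℝ) (ω : Ω) : ℝ :=
  (s - walkX Θ Φ (passageTime Θ Φ s ω - 1) ω) /
    (walkX Θ Φ (passageTime Θ Φ s ω) ω - walkX Θ Φ (passageTime Θ Φ s ω - 1) ω)

/-- The point `Y_s` of the opening `x = 0` through which the ray from `(-s, 0, -1)` exits. -/
def exitPoint (Θ Φ : ℕ → Ω → ℝ) (s : ℝ) (ω : Ω) : ℝ × ℝ × ℝ :=
  (0,
   exitFraction Θ Φ s ω *
      (walkY Θ Φ (passageTime Θ Φ s ω) ω - walkY Θ Φ (passageTime Θ Φ s ω - 1) ω) +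
    walkY Θ Φ (passageTime Θ Φ s ω - 1) ω,
   exitFraction Θ Φ s ω *
      (walkZ Θ Φ (passageTime Θ Φ s ω) ω - walkZ Θ Φ (passageTime Θ Φ s ω - 1) ω) +
    walkZ Θ Φ (passageTime Θ Φ s ω - 1) ω)

/-- The opening `∂_r C` of the cylinder: the closed unit disc in the plane `x = 0`. -/
def opening : Set (ℝ × ℝ × ℝ) := {p | p.2.1 ^ 2 + p.2.2 ^ 2 ≤ 1 ∧ p.1 = 0}

/-- The disc `B_r(0)` in the opening. -/
def openingBall (r : ℝ) : Set (ℝ × ℝ × ℝ) := {p ∈ opening | p.2.1 ^ 2 + p.2.2 ^ 2 ≤ r ^ 2}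

/-- The positive part `(t (U_0 + O_0) - U_0)^+`. -/
def gammaIntegrand (Θ Φ : ℕ → Ω → ℝ) (t : ℝ) (ω : Ω) : ℝ :=
  max (t * (undershoot Θ Φ 0 ω + overshoot Θ Φ 0 ω) - undershoot Θ Φ 0 ω) 0

/-- `Γ(t) = E[(t (U_0 + O_0) - U_0)^+] / E[O_0]`. -/
def limitGamma [MeasurableSpace Ω] (P : Measure Ω) (Θ Φ : ℕ → Ω → ℝ) (t : ℝ) : ℝ :=
  (∫ ω, gammaIntegrand Θ Φ t ω ∂P) / ∫ ω, overshoot Θ Φ 0 ω ∂P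

end

end CylinderLight

/-! The axial coordinate is a random walk with i.i.d. steps $X=R\cos\Phi\sin\Theta$ (`axialStep`).
At fraction $\lambda$ of a chord the squared distance to the axis is
$1-2R\cos\Theta\,\lambda(1-\lambda)$ (`normSq_chord_point`). Hence whether $Y_s$ lies in $B_r(0)$
depends only on the angles of the crossing step and its undershoot (`exitPoint_mem_iff`), and a
two-dimensional exit question becomes one about the first passage of a one-dimensional walk.

Decomposing at the first ladder height gives a renewal equation for the exit probability
(`exitProb_eq`). Its step law $H$ is the law of $O_0$; its forcing term $k(s)$ is the probability
that the first ladder height already exceeds $s$ and that its chord is near the axis at level $s$.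
The key renewal theorem (`tendsto_of_renewal`) yields the limit $\int_0^\infty k/\mathbb E[O_0]$.
Here $\int k$ is the expected length of the set of levels $s\ge0$ at which the first ladder chord is
near the axis. Since $2R\cos\Theta\le4$, such levels satisfy $|2\lambda-1|\le r$, so the length is
at most the difference of the positive parts that define $\Gamma((1+r)/2)$ and $\Gamma((1-r)/2)$
(`volume_nearAxis_le`).

That $H$ is a probability law with finite mean comes from Wiener–Hopf: the step is symmetric and
atomless, so $1-\varphi_X=|1-\varphi_H|^2$ (`one_sub_charFun_eq`). At $t=0$ this gives total mass
one. Comparing imaginary parts with $1-\varphi_X(t)\le t^2\,\mathbb E[X^2]/2$ bounds the sine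
transform of $H$, and thereby its mean by $\sqrt{\mathbb E[X^2]/2}$ (`lintegral_hitMeasure_le`). As
$\mathbb E[X^2]=\pi/2$, this is $\mathbb E[O_0]\le\sqrt\pi/2$.

The explicit bound then uses $(t(U_0+O_0)-U_0)^+\le tO_0$ at $t=(1+r)/2$. At $t=(1-r)/2$ it keeps
only the event that the first step is positive, where the integrand is $tX_1$, together with
$\mathbb E[X_1^+]\ge1-2/\pi$ (`limitGamma_sub_le`). -/

namespace CylinderLight

/-! ### I.i.d. sequences, partial sums and the Markov property at a fixed time. -/

section PathSpace

variable {E : Type*}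

/-- The sequence that follows `x` for `m` steps and then runs through `y`. -/
def concatPath (m : ℕ) (x y : ℕ → E) : ℕ → E := fun i => if i < m then x i else y (i - m)

/-- The sequence `x` after its first `m` terms. -/
def shiftPath (m : ℕ) (x : ℕ → E) : ℕ → E := fun i => x (m + i)

theorem concatPath_of_lt {m i : ℕ} (h : i < m) (x y : ℕ → E) : concatPath m x y i = x i := if_pos h

theorem shiftPath_concatPath (m : ℕ) (x y : ℕ → E) : shiftPath m (concatPath m x y) = y := by
  ext i; simp [shiftPath, concatPath]

/-- The partial sums of `g` along a path. -/
def pathSum (g : E → ℝ) (n : ℕ) (x : ℕ → E) : ℝ := ∑ i ∈ Finset.range n, g (x i)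

theorem pathSum_zero (g : E → ℝ) (x : ℕ → E) : pathSum g 0 x = 0 := by simp [pathSum]

theorem pathSum_succ (g : E → ℝ) (n : ℕ) (x : ℕ → E) :
    pathSum g (n + 1) x = pathSum g n x + g (x n) := Finset.sum_range_succ _ _

theorem pathSum_add (g : E → ℝ) (m n : ℕ) (x : ℕ → E) :
    pathSum g (m + n) x = pathSum g m x + pathSum g n (shiftPath m x) := by
  simp [pathSum, shiftPath, Finset.sum_range_add]

theorem pathSum_congr (g : E → ℝ) {n : ℕ} {x x' : ℕ → E} (h : ∀ i < n, x i = x' i) :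
    pathSum g n x = pathSum g n x' :=
  Finset.sum_congr rfl fun i hi => by rw [h i (Finset.mem_range.1 hi)]

variable [MeasurableSpace E]

theorem measurable_pathSum {g : E → ℝ} (hg : Measurable g) (n : ℕ) : Measurable (pathSum g n) :=
  Finset.measurable_sum _ fun i _ => hg.comp (measurable_pi_apply i)

theorem measurable_concatPath (m : ℕ) :
    Measurable fun p : (ℕ → E) × (ℕ → E) => concatPath m p.1 p.2 := by
  refine measurable_pi_lambda _ fun i => ?_
  by_cases h : i < m
  · simp only [concatPath, h, if_true]
    exact (measurable_pi_apply i).comp measurable_fst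
  · simp only [concatPath, h, if_false]
    exact (measurable_pi_apply (i - m)).comp measurable_snd

theorem measurable_shiftPath (m : ℕ) : Measurable (shiftPath m : (ℕ → E) → ℕ → E) :=
  measurable_pi_lambda _ fun i => measurable_pi_apply (m + i)

/-- The law of an i.i.d. sequence with marginal `ν`. -/
noncomputable abbrev iidLaw (ν : Measure E) [IsProbabilityMeasure ν] : Measure (ℕ → E) :=
  Measure.infinitePi fun _ : ℕ => ν

/-- Coordinates below `m` are read from one copy and the remaining ones, shifted by `m`, from an
independent copy. A cylinder set therefore pulls back to a rectangle, and its mass is the same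
product of marginals regrouped at `m`. -/
theorem map_concatPath (ν : Measure E) [IsProbabilityMeasure ν] (m : ℕ) :
    ((iidLaw ν).prod (iidLaw ν)).map (fun p => concatPath m p.1 p.2) = iidLaw ν := by
  refine Measure.eq_infinitePi _ fun s t ht => ?_
  have hpre : (fun p : (ℕ → E) × (ℕ → E) => concatPath m p.1 p.2) ⁻¹' Set.pi s t =
      (Set.pi (s.filter (· < m) : Finset ℕ) t) ×ˢ
        (Set.pi ((s.filter (¬ · < m)).image (· - m) : Finset ℕ) fun j => t (j + m)) := by
    ext ⟨x, y⟩
    simp only [Set.mem_preimage, Set.mem_pi, SetLike.mem_coe, Set.mem_prod, Finset.mem_filter,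
      Finset.mem_image, concatPath]
    constructor
    · intro h
      refine ⟨fun i hi => by simpa [hi.2] using h i hi.1, ?_⟩
      rintro j ⟨i, ⟨hi, him⟩, rfl⟩
      have := h i hi
      rw [if_neg him] at this
      rwa [Nat.sub_add_cancel (not_lt.1 him)]
    · rintro ⟨h1, h2⟩ i hi
      split_ifs with him
      · exact h1 i ⟨hi, him⟩
      · have := h2 (i - m) ⟨i, ⟨hi, him⟩, rfl⟩
        rwa [Nat.sub_add_cancel (not_lt.1 him)] at this
  rw [Measure.map_apply (measurable_concatPath m)
    (MeasurableSet.pi s.countable_toSet fun i _ => ht i), hpre, Measure.prod_prod,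
    Measure.infinitePi_pi _ fun i _ => ht i, Measure.infinitePi_pi _ fun i _ => ht _,
    Finset.prod_image, ← Finset.prod_filter_mul_prod_filter_not s (· < m)]
  · congr 1
    refine Finset.prod_congr rfl fun i hi => ?_
    rw [Nat.sub_add_cancel (not_lt.1 (Finset.mem_filter.1 hi).2)]
  · intro i hi j hj hij
    have h1 := (Finset.mem_filter.1 hi).2
    have h2 := (Finset.mem_filter.1 hj).2
    simp only at hij
    omega

/-- The Markov property at time `m`. -/
theorem lintegral_shiftPath (ν : Measure E) [IsProbabilityMeasure ν] (m : ℕ)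
    {F : (ℕ → E) → (ℕ → E) → ENNReal} (hF : Measurable (Function.uncurry F))
    (hm : ∀ x x' y, (∀ i < m, x i = x' i) → F x y = F x' y) :
    ∫⁻ x, F x (shiftPath m x) ∂(iidLaw ν) = ∫⁻ x, ∫⁻ y, F x y ∂(iidLaw ν) ∂(iidLaw ν) := by
  have hmeas : Measurable fun x => F x (shiftPath m x) :=
    hF.comp (measurable_id.prodMk (measurable_shiftPath m))
  conv_lhs => rw [← map_concatPath ν m]
  rw [lintegral_map hmeas (measurable_concatPath m)]
  refine Eq.trans ?_ (lintegral_prod _ hF.aemeasurable)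
  refine lintegral_congr fun p => ?_
  rw [shiftPath_concatPath]
  exact hm _ _ _ fun i hi => concatPath_of_lt hi _ _

end PathSpace
end CylinderLight

namespace CylinderLight

/-! ### From a sine transform bound to a bound on the mean. -/

section MeanBound
open Set Real

theorem integrableOn_exp_neg_mul_Ioi {ε : ℝ} (hε : 0 < ε) :
    IntegrableOn (fun t => Real.exp (-ε * t)) (Ioi 0) := by
  simpa using integrableOn_exp_mul_Ioi (a := -ε) (by linarith) 0

/-- This kernel makes the sine transform usable: $\varepsilon^2x/(\varepsilon^2+x^2)$ tends to $x$
as $\varepsilon\to\infty$. -/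
theorem integral_sin_mul_exp_neg {ε : ℝ} (hε : 0 < ε) (x : ℝ) :
    ∫ t in Ioi (0 : ℝ), Real.sin (t * x) * Real.exp (-ε * t) = x / (ε ^ 2 + x ^ 2) := by
  have hd : ε ^ 2 + x ^ 2 ≠ 0 := by positivity
  have hder : ∀ t ∈ Ici (0 : ℝ), HasDerivAt
      (fun t => -(Real.exp (-ε * t) * (ε * Real.sin (t * x) + x * Real.cos (t * x))) /
        (ε ^ 2 + x ^ 2)) (Real.sin (t * x) * Real.exp (-ε * t)) t := by
    intro t _
    have h1 : HasDerivAt (fun t : ℝ => Real.exp (-ε * t)) (Real.exp (-ε * t) * (-ε)) t := by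
      simpa using ((hasDerivAt_id t).const_mul (-ε)).exp
    have h2 : HasDerivAt (fun t : ℝ => Real.sin (t * x)) (Real.cos (t * x) * x) t := by
      simpa using ((hasDerivAt_id t).mul_const x).sin
    have h3 : HasDerivAt (fun t : ℝ => Real.cos (t * x)) (-Real.sin (t * x) * x) t := by
      simpa using ((hasDerivAt_id t).mul_const x).cos
    refine ((h1.mul ((h2.const_mul ε).add (h3.const_mul x))).neg.div_const _).congr_deriv ?_
    simp only [Pi.add_apply]
    field_simp
    ring
  have hint : IntegrableOn (fun t => Real.sin (t * x) * Real.exp (-ε * t)) (Ioi 0) := by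
    refine (integrableOn_exp_neg_mul_Ioi hε).mono'
      (by fun_prop) (Eventually.of_forall fun t => ?_)
    rw [norm_mul, Real.norm_eq_abs, Real.norm_eq_abs, abs_of_pos (Real.exp_pos _)]
    exact mul_le_of_le_one_left (Real.exp_pos _).le (Real.abs_sin_le_one _)
  have hexp : Tendsto (fun t : ℝ => Real.exp (-ε * t)) atTop (𝓝 0) :=
    Real.tendsto_exp_atBot.comp (tendsto_id.const_mul_atTop_of_neg (by linarith))
  have hlim : Tendsto (fun t => -(Real.exp (-ε * t) *
      (ε * Real.sin (t * x) + x * Real.cos (t * x))) / (ε ^ 2 + x ^ 2)) atTop (𝓝 0) := by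
    have hb : Tendsto (fun t => Real.exp (-ε * t) *
        (ε * Real.sin (t * x) + x * Real.cos (t * x))) atTop (𝓝 0) := by
      refine hexp.zero_mul_isBoundedUnder_le ⟨ε + |x|, ?_⟩
      simp only [eventually_map]
      refine Eventually.of_forall fun t => ?_
      simp only [Function.comp, Real.norm_eq_abs]
      calc |ε * Real.sin (t * x) + x * Real.cos (t * x)|
          ≤ |ε * Real.sin (t * x)| + |x * Real.cos (t * x)| := abs_add_le _ _
        _ ≤ ε * 1 + |x| * 1 := by
          rw [abs_mul, abs_mul, abs_of_pos hε]
          gcongr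
          · exact Real.abs_sin_le_one _
          · exact Real.abs_cos_le_one _
        _ = ε + |x| := by ring
    simpa using hb.neg.div_const (ε ^ 2 + x ^ 2)
  rw [integral_Ioi_of_hasDerivAt_of_tendsto' hder hint hlim]
  simp [neg_div]

theorem integral_mul_exp_neg {ε : ℝ} (hε : 0 < ε) :
    IntegrableOn (fun t => t * Real.exp (-ε * t)) (Ioi 0) ∧
      ∫ t in Ioi (0 : ℝ), t * Real.exp (-ε * t) = 1 / ε ^ 2 := by
  have hder : ∀ t ∈ Ici (0 : ℝ), HasDerivAt
      (fun t => -((t / ε + 1 / ε ^ 2) * Real.exp (-ε * t))) (t * Real.exp (-ε * t)) t := by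
    intro t _
    have h1 : HasDerivAt (fun t : ℝ => Real.exp (-ε * t)) (Real.exp (-ε * t) * (-ε)) t := by
      simpa using ((hasDerivAt_id t).const_mul (-ε)).exp
    refine (((((hasDerivAt_id t).div_const ε).add_const (1 / ε ^ 2)).mul h1).neg).congr_deriv ?_
    simp only [id]
    field_simp
    ring
  have hpos : ∀ t ∈ Ioi (0 : ℝ), 0 ≤ t * Real.exp (-ε * t) := fun t ht =>
    mul_nonneg (le_of_lt ht) (Real.exp_pos _).le
  have hlim : Tendsto (fun t => -((t / ε + 1 / ε ^ 2) * Real.exp (-ε * t))) atTop (𝓝 0) := by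
    have h0 : Tendsto (fun t : ℝ => Real.exp (-ε * t)) atTop (𝓝 0) :=
      Real.tendsto_exp_atBot.comp (tendsto_id.const_mul_atTop_of_neg (by linarith))
    have h1 : Tendsto (fun t : ℝ => t * Real.exp (-ε * t)) atTop (𝓝 0) := by
      have := (Real.tendsto_pow_mul_exp_neg_atTop_nhds_zero 1).comp
        (tendsto_id.const_mul_atTop hε)
      have := this.const_mul (1 / ε)
      rw [mul_zero] at this
      refine this.congr fun t => ?_
      simp only [Function.comp, id, pow_one]
      field_simp
    have := ((h1.const_mul (1 / ε)).add (h0.const_mul (1 / ε ^ 2))).neg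
    simp only [mul_zero, add_zero, neg_zero] at this
    refine this.congr fun t => by ring
  refine ⟨integrableOn_Ioi_deriv_of_nonneg' hder hpos hlim, ?_⟩
  rw [integral_Ioi_of_hasDerivAt_of_nonneg' hder hpos hlim]
  simp

/-- A bound on the sine transform of a law on the half-line bounds its mean. -/
theorem lintegral_le_of_integral_sin_le (H : Measure ℝ) [IsProbabilityMeasure H]
    (h0 : H (Iio 0) = 0) {C : ℝ} (hs : ∀ t > 0, ∫ x, Real.sin (t * x) ∂H ≤ C * t) :
    ∫⁻ x, ENNReal.ofReal x ∂H ≤ ENNReal.ofReal C := by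
  -- Integrate the hypothesis against $e^{-\varepsilon t}\,dt$ and exchange the two integrals.
  have key : ∀ ε : ℝ, 0 < ε → ∫ x, x / (ε ^ 2 + x ^ 2) ∂H ≤ C / ε ^ 2 := by
    intro ε hε
    have hint : Integrable (fun p : ℝ × ℝ => Real.sin (p.2 * p.1) * Real.exp (-ε * p.2))
        (H.prod (volume.restrict (Ioi 0))) := by
      refine Integrable.mono' ((integrableOn_exp_neg_mul_Ioi hε).integrable.comp_snd H)
        (by fun_prop) (Eventually.of_forall fun p => ?_)
      rw [norm_mul, Real.norm_eq_abs, Real.norm_eq_abs, abs_of_pos (Real.exp_pos _)]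
      exact mul_le_of_le_one_left (Real.exp_pos _).le (Real.abs_sin_le_one _)
    calc ∫ x, x / (ε ^ 2 + x ^ 2) ∂H
        = ∫ x, (∫ t in Ioi (0 : ℝ), Real.sin (t * x) * Real.exp (-ε * t)) ∂H :=
          integral_congr_ae (Eventually.of_forall fun x => (integral_sin_mul_exp_neg hε x).symm)
      _ = ∫ t in Ioi (0 : ℝ), (∫ x, Real.sin (t * x) * Real.exp (-ε * t) ∂H) :=
          integral_integral_swap hint
      _ ≤ ∫ t in Ioi (0 : ℝ), C * (t * Real.exp (-ε * t)) := by
          refine setIntegral_mono_on hint.integral_prod_right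
            ((integral_mul_exp_neg hε).1.const_mul C) measurableSet_Ioi fun t ht => ?_
          rw [integral_mul_const, ← mul_assoc]
          exact mul_le_mul_of_nonneg_right (hs t ht) (Real.exp_pos _).le
      _ = C / ε ^ 2 := by rw [integral_const_mul, (integral_mul_exp_neg hε).2]; ring
  have hpos : ∀ᵐ x ∂H, 0 ≤ x := by
    rw [ae_iff]; simpa [Iio] using h0
  -- Multiply by $\varepsilon^2$ at $\varepsilon=n+1$: the bound $C$ no longer depends on
  -- $\varepsilon$, and Fatou's lemma passes to the limit without any prior integrability.
  have bound : ∀ n : ℕ, ∫⁻ x, ENNReal.ofReal (x * ((n + 1 : ℝ) ^ 2 / ((n + 1 : ℝ) ^ 2 + x ^ 2))) ∂H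
      ≤ ENNReal.ofReal C := by
    intro n
    have hn : (0 : ℝ) < n + 1 := by positivity
    have hi : Integrable (fun x : ℝ => x / ((n + 1 : ℝ) ^ 2 + x ^ 2)) H := by
      refine Integrable.of_bound (by measurability : Measurable _).aestronglyMeasurable 1
        (Eventually.of_forall fun x => ?_)
      rw [Real.norm_eq_abs, abs_div, abs_of_pos (by positivity : (0:ℝ) < (n + 1 : ℝ) ^ 2 + x ^ 2),
        div_le_one (by positivity)]
      have : (0 : ℝ) ≤ n := by positivity
      nlinarith [sq_abs x, sq_nonneg (|x| - 1), abs_nonneg x]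
    have h2 : ∀ x : ℝ, x * ((n + 1 : ℝ) ^ 2 / ((n + 1 : ℝ) ^ 2 + x ^ 2)) =
        (n + 1 : ℝ) ^ 2 * (x / ((n + 1 : ℝ) ^ 2 + x ^ 2)) := fun x => by ring
    simp_rw [h2]
    rw [← ofReal_integral_eq_lintegral_ofReal (hi.const_mul _)]
    · refine ENNReal.ofReal_le_ofReal ?_
      rw [integral_const_mul]
      calc (n + 1 : ℝ) ^ 2 * _ ≤ (n + 1 : ℝ) ^ 2 * (C / (n + 1 : ℝ) ^ 2) :=
            mul_le_mul_of_nonneg_left (key _ hn) (by positivity)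
        _ = C := by field_simp
    · filter_upwards [hpos] with x hx
      positivity
  have hlim : ∀ x : ℝ, Tendsto (fun n : ℕ =>
      ENNReal.ofReal (x * ((n + 1 : ℝ) ^ 2 / ((n + 1 : ℝ) ^ 2 + x ^ 2)))) atTop
      (𝓝 (ENNReal.ofReal x)) := by
    intro x
    refine ENNReal.tendsto_ofReal ?_
    have h1 : Tendsto (fun n : ℕ => x ^ 2 / ((n + 1 : ℝ)) ^ 2) atTop (𝓝 0) := by
      refine tendsto_const_nhds.div_atTop ?_
      exact (tendsto_pow_atTop two_ne_zero).comp
        (tendsto_natCast_atTop_atTop.atTop_add tendsto_const_nhds)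
    have h2 := ((h1.const_add 1).inv₀ (by norm_num)).const_mul x
    simp only [add_zero, inv_one, mul_one] at h2
    refine h2.congr fun n => ?_
    field_simp
  calc ∫⁻ x, ENNReal.ofReal x ∂H
      = ∫⁻ x, liminf (fun n : ℕ =>
          ENNReal.ofReal (x * ((n + 1 : ℝ) ^ 2 / ((n + 1 : ℝ) ^ 2 + x ^ 2)))) atTop ∂H :=
        lintegral_congr fun x => (hlim x).liminf_eq.symm
    _ ≤ liminf (fun n : ℕ => ∫⁻ x,
          ENNReal.ofReal (x * ((n + 1 : ℝ) ^ 2 / ((n + 1 : ℝ) ^ 2 + x ^ 2))) ∂H) atTop :=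
        lintegral_liminf_le fun n => by fun_prop
    _ ≤ ENNReal.ofReal C :=
        liminf_le_of_le (by isBoundedDefault) fun b hb => by
          obtain ⟨n, hn⟩ := hb.exists
          exact hn.trans (bound n)

end MeanBound
end CylinderLight

namespace CylinderLight

/-! ### The key renewal theorem. -/

section Renewal
open Set
open scoped ENNReal

/-- The renewal equation integrated over `[0, s]`. -/
theorem setLIntegral_renewal {H : Measure ℝ} [IsProbabilityMeasure H] (hpos : H (Iic 0) = 0)
    {u k : ℝ → ℝ≥0∞} (hu : Measurable u) (hk : Measurable k) (hu1 : ∀ s, u s ≤ 1)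
    (hu0 : ∀ s < 0, u s = 0) (heq : ∀ s ≥ 0, u s = k s + ∫⁻ y, u (s - y) ∂H) (s : ℝ) :
    ∫⁻ y in Icc 0 s, u (s - y) * H (Ioi y) = ∫⁻ y in Icc 0 s, k y := by
  have hH : ∀ᵐ y ∂H, 0 < y := by rw [ae_iff]; simpa [Iic] using hpos
  have hfin : ∫⁻ w in Icc 0 s, u w ≠ ⊤ := by
    refine ((lintegral_mono fun w => hu1 w).trans_lt ?_).ne
    simp
  have hIic : Measurable fun w : ℝ => H (Iic (s - w)) :=
    (show Antitone fun w : ℝ => H (Iic (s - w)) from fun a b hab =>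
      measure_mono (Iic_subset_Iic.2 (by linarith))).measurable
  -- Tonelli with $z=w+y$. Since $u$ vanishes on negative levels and $H$ lives on positive ones,
  -- only $0\le w\le s$ and $0<y\le s-w$ contribute.
  have hconv : ∫⁻ z in Icc 0 s, ∫⁻ y, u (z - y) ∂H = ∫⁻ w in Icc 0 s, u w * H (Iic (s - w)) := by
    have hm1 : Measurable fun p : ℝ × ℝ => (Icc 0 s).indicator (fun _ => u (p.1 - p.2)) p.1 := by
      have : (fun p : ℝ × ℝ => (Icc 0 s).indicator (fun _ => u (p.1 - p.2)) p.1) =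
          (Prod.fst ⁻¹' Icc 0 s).indicator fun p : ℝ × ℝ => u (p.1 - p.2) := by
        ext p; simp [indicator]
      rw [this]
      exact (hu.comp (measurable_fst.sub measurable_snd)).indicator
        (measurable_fst measurableSet_Icc)
    have hm2 : Measurable fun p : ℝ × ℝ => (Icc 0 s).indicator (fun _ => u p.1) (p.1 + p.2) := by
      have : (fun p : ℝ × ℝ => (Icc 0 s).indicator (fun _ => u p.1) (p.1 + p.2)) =
          ((fun p : ℝ × ℝ => p.1 + p.2) ⁻¹' Icc 0 s).indicator fun p : ℝ × ℝ => u p.1 := by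
        ext p; simp [indicator]
      rw [this]
      exact (hu.comp measurable_fst).indicator
        ((measurable_fst.add measurable_snd) measurableSet_Icc)
    calc ∫⁻ z in Icc 0 s, ∫⁻ y, u (z - y) ∂H
        = ∫⁻ z, ∫⁻ y, (Icc 0 s).indicator (fun _ => u (z - y)) z ∂H := by
          rw [← lintegral_indicator measurableSet_Icc]
          refine lintegral_congr fun z => ?_
          by_cases hz : z ∈ Icc 0 s <;> simp [hz]
      _ = ∫⁻ y, (∫⁻ z, (Icc 0 s).indicator (fun _ => u (z - y)) z) ∂H :=
          lintegral_lintegral_swap hm1.aemeasurable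
      _ = ∫⁻ y, (∫⁻ w, (Icc 0 s).indicator (fun _ => u w) (w + y)) ∂H := by
          refine lintegral_congr fun y => ?_
          rw [← lintegral_add_right_eq_self _ y]
          simp
      _ = ∫⁻ w, ∫⁻ y, (Icc 0 s).indicator (fun _ => u w) (w + y) ∂H :=
          (lintegral_lintegral_swap hm2.aemeasurable).symm
      _ = ∫⁻ w in Icc 0 s, u w * H (Iic (s - w)) := by
          rw [← lintegral_indicator measurableSet_Icc]
          refine lintegral_congr fun w => ?_
          rcases lt_or_ge w 0 with hw | hw
          · simp [hu0 w hw, hw]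
          · have : ∫⁻ y, (Icc 0 s).indicator (fun _ => u w) (w + y) ∂H =
                u w * H (Iic (s - w)) := by
              rw [← setLIntegral_const, ← lintegral_indicator measurableSet_Iic]
              refine lintegral_congr_ae ?_
              filter_upwards [hH] with y hy
              have : w + y ∈ Icc 0 s ↔ y ∈ Iic (s - w) := by
                simp only [mem_Icc, mem_Iic]
                constructor
                · intro h; linarith [h.2]
                · intro h; constructor <;> linarith
              by_cases h : y ∈ Iic (s - w)
              · rw [indicator_of_mem (this.2 h), indicator_of_mem h]
              · rw [indicator_of_notMem (mt this.1 h), indicator_of_notMem h]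
            rw [this]
            by_cases hw' : w ≤ s
            · rw [indicator_of_mem (show w ∈ Icc 0 s from ⟨hw, hw'⟩)]
            · rw [indicator_of_notMem (fun h => hw' h.2)]
              have : H (Iic (s - w)) = 0 :=
                measure_mono_null (Iic_subset_Iic.2 (by linarith)) hpos
              rw [this, mul_zero]
  -- The integral of $u$ is written in two ways: by splitting the unit mass of $H$ at $s-w$, and by
  -- integrating the renewal equation. Cancelling the common finite convolution term leaves the
  -- claim, up to the reflection $w\mapsto s-w$.
  have h1 : ∫⁻ w in Icc 0 s, u w =
      (∫⁻ w in Icc 0 s, u w * H (Iic (s - w))) + ∫⁻ w in Icc 0 s, u w * H (Ioi (s - w)) := by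
    rw [← lintegral_add_left (show Measurable fun w => u w * H (Iic (s - w)) from hu.mul hIic)]
    refine lintegral_congr fun w => ?_
    rw [← mul_add, ← compl_Iic, prob_add_prob_compl measurableSet_Iic, mul_one]
  have h2 : ∫⁻ w in Icc 0 s, u w =
      (∫⁻ w in Icc 0 s, u w * H (Iic (s - w))) + ∫⁻ w in Icc 0 s, k w := by
    rw [← hconv, add_comm, ← lintegral_add_left hk]
    exact setLIntegral_congr_fun measurableSet_Icc fun w hw => heq w hw.1
  have h3 : ∫⁻ w in Icc 0 s, u w * H (Ioi (s - w)) = ∫⁻ w in Icc 0 s, k w := by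
    have hle : ∫⁻ w in Icc 0 s, u w * H (Iic (s - w)) ≠ ⊤ :=
      ne_top_of_le_ne_top hfin (h1 ▸ le_self_add)
    exact (ENNReal.add_right_inj hle).1 (h1.symm.trans h2)
  rw [← h3, ← lintegral_indicator measurableSet_Icc, ← lintegral_indicator measurableSet_Icc,
    ← lintegral_sub_left_eq_self _ s]
  refine lintegral_congr fun w => ?_
  have : s - w ∈ Icc 0 s ↔ w ∈ Icc 0 s := by
    simp only [mem_Icc]; constructor <;> rintro ⟨a, b⟩ <;> constructor <;> linarith
  by_cases h : w ∈ Icc 0 s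
  · rw [indicator_of_mem (this.2 h), indicator_of_mem h, sub_sub_cancel]
  · rw [indicator_of_notMem (mt this.1 h), indicator_of_notMem h]

theorem tendsto_setLIntegral_Icc_natCast {f : ℝ → ℝ≥0∞} :
    Tendsto (fun n : ℕ => ∫⁻ y in Icc (0 : ℝ) n, f y) atTop (𝓝 (∫⁻ y in Ici 0, f y)) := by
  have hU : Ici (0 : ℝ) = ⋃ n : ℕ, Icc (0 : ℝ) n := by
    ext x
    simp only [mem_Ici, mem_iUnion, mem_Icc]
    exact ⟨fun h => (exists_nat_ge x).imp fun n hn => ⟨h, hn⟩, fun ⟨n, h, _⟩ => h⟩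
  have hmono : Monotone fun n : ℕ => Icc (0 : ℝ) n := fun a b hab =>
    Icc_subset_Icc_right (by exact_mod_cast hab)
  rw [hU, setLIntegral_iUnion_of_directed f hmono.directed_le]
  exact tendsto_atTop_iSup fun a b hab => lintegral_mono_set (hmono hab)

/-- The domination of Lebesgue measure enters the renewal theorem here: smallness in $L^1(H)$
becomes smallness in $L^1(dy)$ on a bounded interval, as needed to pass to the limit in the
integrated renewal equation. -/
theorem tendsto_setLIntegral_of_tendsto_lintegral {H : Measure ℝ} {T : ℝ} {δ : ℝ≥0∞} (hδ : δ ≠ 0)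
    (hδ' : δ ≠ ⊤) (hH : δ • volume.restrict (Icc 0 T) ≤ H) {f : ℕ → ℝ → ℝ≥0∞}
    (hf : Tendsto (fun n => ∫⁻ y, f n y ∂H) atTop (𝓝 0)) :
    Tendsto (fun n => ∫⁻ y in Icc 0 T, f n y) atTop (𝓝 0) := by
  have h1 : Tendsto (fun n => δ⁻¹ * ∫⁻ y, f n y ∂H) atTop (𝓝 0) := by
    simpa using ENNReal.Tendsto.const_mul hf (Or.inr (ENNReal.inv_ne_top.2 hδ))
  refine tendsto_of_tendsto_of_tendsto_of_le_of_le tendsto_const_nhds h1 (fun _ => zero_le)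
    fun n => ?_
  calc ∫⁻ y in Icc 0 T, f n y = δ⁻¹ * (δ * ∫⁻ y in Icc 0 T, f n y) := by
        rw [← mul_assoc, ENNReal.inv_mul_cancel hδ hδ', one_mul]
    _ = δ⁻¹ * ∫⁻ y, f n y ∂(δ • volume.restrict (Icc 0 T)) := by
        rw [lintegral_smul_measure, smul_eq_mul]
    _ ≤ δ⁻¹ * ∫⁻ y, f n y ∂H := by
        gcongr

theorem lintegral_Ici_measure_Ioi {H : Measure ℝ} (hpos : H (Iic 0) = 0) :
    ∫⁻ y in Ici 0, H (Ioi y) = ∫⁻ y, ENNReal.ofReal y ∂H := by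
  have hH : ∀ᵐ y ∂H, 0 ≤ y := by
    rw [ae_iff]; refine measure_mono_null (fun y hy => ?_) hpos
    exact (not_le.1 hy).le
  calc ∫⁻ y in Ici 0, H (Ioi y) = ∫⁻ y in Ioi 0, H (Ioi y) :=
        setLIntegral_congr Ioi_ae_eq_Ici.symm
    _ = ∫⁻ y, ENNReal.ofReal y ∂H :=
        (lintegral_eq_lintegral_meas_lt H hH aemeasurable_id).symm

theorem lintegral_ofReal_ne_zero {H : Measure ℝ} [IsProbabilityMeasure H] (hpos : H (Iic 0) = 0) :
    ∫⁻ y, ENNReal.ofReal y ∂H ≠ 0 := by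
  have hH : ∀ᵐ y ∂H, 0 < y := by rw [ae_iff]; simpa [Iic] using hpos
  intro h
  rw [lintegral_eq_zero_iff (by fun_prop)] at h
  have : ∀ᵐ y ∂H, False := by
    filter_upwards [hH, h] with y hy h'
    have : y ≤ 0 := by simpa using h'
    linarith
  exact absurd (by simpa using this) (IsProbabilityMeasure.ne_zero H)

/-- The key renewal theorem, for step laws which dominate a multiple of Lebesgue measure on every
bounded interval of the half-line. -/
theorem tendsto_of_renewal {H : Measure ℝ} [IsProbabilityMeasure H] (hpos : H (Iic 0) = 0)
    (hmean : ∫⁻ y, ENNReal.ofReal y ∂H ≠ ⊤)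
    (hlow : ∀ T : ℝ, ∃ δ : ℝ≥0∞, δ ≠ 0 ∧ δ ≠ ⊤ ∧ δ • volume.restrict (Icc 0 T) ≤ H)
    {u k : ℝ → ℝ≥0∞} (hu : Measurable u) (hk : Measurable k) (hu1 : ∀ s, u s ≤ 1)
    (hu0 : ∀ s < 0, u s = 0) (heq : ∀ s ≥ 0, u s = k s + ∫⁻ y, u (s - y) ∂H)
    (hk0 : Tendsto k atTop (𝓝 0)) :
    Tendsto u atTop (𝓝 ((∫⁻ s in Ici 0, k s) / ∫⁻ y, ENNReal.ofReal y ∂H)) := by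
  have hmean0 := lintegral_ofReal_ne_zero hpos
  rw [← lintegral_Ici_measure_Ioi hpos] at *
  have hρ : Measurable fun w : ℝ => H (Ioi w) :=
    (show Antitone fun w : ℝ => H (Ioi w) from fun a b hab =>
      measure_mono (Ioi_subset_Ioi hab)).measurable
  have hρ1 : ∀ w, H (Ioi w) ≤ 1 := fun w => prob_le_one
  have hum : ∀ s : ℝ, Measurable fun y => u (s - y) := fun s =>
    hu.comp (measurable_const.sub measurable_id)
  have hshift : ∀ y : ℝ, Tendsto (fun s : ℝ => s - y) atTop atTop := fun y =>
    tendsto_atTop_add_const_right _ _ tendsto_id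
  refine tendsto_of_le_liminf_of_limsup_le ?_ ?_
  · -- the lower bound
    obtain ⟨s, hus, hs⟩ := exists_seq_tendsto_liminf (f := (atTop : Filter ℝ)) (u := u)
    set m := liminf u atTop with hm
    have hm1 : m ≤ 1 := by
      refine le_of_tendsto hus (Eventually.of_forall fun n => hu1 _)
    -- Along a sequence realizing the liminf, the renewal equation forces the $H$-average of
    -- $u(s_n-y)$ to $m$. The truncation $\min(m,u(s_n-y))$ also averages to $m$, because $m$ is an
    -- asymptotic lower bound of $u$. The truncated subtraction is their difference, so the excess
    -- over $m$ vanishes in $L^1(H)$.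
    have hconv : Tendsto (fun n => ∫⁻ y, (u (s n - y) - m) ∂H) atTop (𝓝 0) := by
      have hmin : Tendsto (fun n => ∫⁻ y, min m (u (s n - y)) ∂H) atTop (𝓝 m) := by
        have : Tendsto (fun n => ∫⁻ y, min m (u (s n - y)) ∂H) atTop (𝓝 (∫⁻ _, m ∂H)) := by
          refine tendsto_lintegral_of_dominated_convergence (fun _ => 1)
            (fun n => measurable_const.min (hum _))
            (fun n => Eventually.of_forall fun y => (min_le_left _ _).trans hm1) (by simp)
            (Eventually.of_forall fun y => ?_)
          refine tendsto_order.2 ⟨fun a ha => ?_, fun a ha => ?_⟩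
          · have h := ((hshift y).comp hs).eventually (eventually_lt_of_lt_liminf (hm ▸ ha))
            filter_upwards [h] with n hn
            exact lt_min ha hn
          · exact Eventually.of_forall fun n => (min_le_left _ _).trans_lt ha
        simpa using this
      have hu' : Tendsto (fun n => ∫⁻ y, u (s n - y) ∂H) atTop (𝓝 m) := by
        have h := ENNReal.Tendsto.sub hus (hk0.comp hs) (Or.inr ENNReal.zero_ne_top)
        rw [tsub_zero] at h
        refine h.congr' ?_
        filter_upwards [hs.eventually_ge_atTop 0] with n hn
        have hkn : k (s n) ≠ ⊤ := ne_top_of_le_ne_top ENNReal.one_ne_top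
          ((heq _ hn ▸ le_self_add : k (s n) ≤ u (s n)).trans (hu1 _))
        simp only [Function.comp]
        rw [heq _ hn, ENNReal.add_sub_cancel_left hkn]
      have h := ENNReal.Tendsto.sub hu' hmin (Or.inr (ne_top_of_le_ne_top ENNReal.one_ne_top hm1))
      rw [tsub_self] at h
      refine h.congr fun n => ?_
      rw [← lintegral_sub (measurable_const.min (hum _))]
      · refine lintegral_congr fun y => ?_
        rcases le_total m (u (s n - y)) with h | h
        · rw [min_eq_left h]
        · rw [min_eq_right h, tsub_self, tsub_eq_zero_of_le h]
      · refine ne_top_of_le_ne_top ENNReal.one_ne_top ?_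
        calc _ ≤ ∫⁻ _, 1 ∂H := lintegral_mono fun y => (min_le_left _ _).trans hm1
          _ = 1 := by simp
      · exact Eventually.of_forall fun y => min_le_right _ _
    -- In the integrated equation replace $u(s_n-y)$ by $m$ plus its excess for $y\le N$, and by $1$
    -- for $y>N$. The excess vanishes as $n\to\infty$, and what remains is a tail of the convergent
    -- integral of $H(y,\infty)$, removed by $N\to\infty$.
    have hT : ∀ N : ℕ, ∫⁻ y in Ici 0, k y ≤
        m * (∫⁻ y in Ici 0, H (Ioi y)) + ((∫⁻ y in Ici 0, H (Ioi y)) -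
          ∫⁻ y in Icc (0 : ℝ) N, H (Ioi y)) := by
      intro N
      obtain ⟨δ, hδ, hδ', hle⟩ := hlow N
      have hz := tendsto_setLIntegral_of_tendsto_lintegral hδ hδ' hle hconv
      have hlhs : Tendsto (fun n => ∫⁻ y in Icc 0 (s n), k y) atTop (𝓝 (∫⁻ y in Ici 0, k y)) := by
        refine tendsto_order.2 ⟨fun a ha => ?_, fun a ha => Eventually.of_forall fun n =>
          (lintegral_mono_set Icc_subset_Ici_self).trans_lt ha⟩
        obtain ⟨M, hM⟩ := (tendsto_setLIntegral_Icc_natCast.eventually (lt_mem_nhds ha)).exists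
        filter_upwards [hs.eventually_ge_atTop (M : ℝ)] with n hn
        exact hM.trans_le (lintegral_mono_set (Icc_subset_Icc_right hn))
      have hrhs := (hz.const_add (m * ∫⁻ y in Ici 0, H (Ioi y))).add_const
        ((∫⁻ y in Ici 0, H (Ioi y)) - ∫⁻ y in Icc (0 : ℝ) N, H (Ioi y))
      rw [add_zero] at hrhs
      refine le_of_tendsto_of_tendsto hlhs hrhs (Eventually.of_forall fun n => ?_)
      have hfinN : ∫⁻ y in Icc (0 : ℝ) N, H (Ioi y) ≠ ⊤ :=
        ne_top_of_le_ne_top hmean (lintegral_mono_set Icc_subset_Ici_self)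
      have htail : (∫⁻ y in Ici 0, H (Ioi y)) - ∫⁻ y in Icc (0 : ℝ) N, H (Ioi y) =
          ∫⁻ y in Ioi (N : ℝ), H (Ioi y) := by
        rw [← Icc_union_Ioi_eq_Ici (Nat.cast_nonneg N), lintegral_union measurableSet_Ioi,
          ENNReal.add_sub_cancel_left hfinN]
        exact Set.disjoint_left.2 fun y hy hy' => not_lt.2 hy.2 hy'
      calc ∫⁻ y in Icc 0 (s n), k y = ∫⁻ y in Icc 0 (s n), u (s n - y) * H (Ioi y) :=
            (setLIntegral_renewal hpos hu hk hu1 hu0 heq _).symm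
        _ ≤ ∫⁻ y in Ici 0, u (s n - y) * H (Ioi y) := lintegral_mono_set Icc_subset_Ici_self
        _ = (∫⁻ y in Icc (0 : ℝ) N, u (s n - y) * H (Ioi y)) +
              ∫⁻ y in Ioi (N : ℝ), u (s n - y) * H (Ioi y) := by
            rw [← Icc_union_Ioi_eq_Ici (Nat.cast_nonneg N), lintegral_union measurableSet_Ioi]
            exact Set.disjoint_left.2 fun y hy hy' => not_lt.2 hy.2 hy'
        _ ≤ (∫⁻ y in Icc (0 : ℝ) N, (m * H (Ioi y) + (u (s n - y) - m))) +
              ∫⁻ y in Ioi (N : ℝ), H (Ioi y) := by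
            gcongr with y y
            · calc u (s n - y) * H (Ioi y) ≤ (m + (u (s n - y) - m)) * H (Ioi y) := by
                    gcongr; exact le_add_tsub
                _ = m * H (Ioi y) + (u (s n - y) - m) * H (Ioi y) := add_mul _ _ _
                _ ≤ m * H (Ioi y) + (u (s n - y) - m) * 1 := by gcongr; exact hρ1 y
                _ = _ := by rw [mul_one]
            · exact mul_le_of_le_one_left zero_le (hu1 _)
        _ = m * (∫⁻ y in Icc (0 : ℝ) N, H (Ioi y)) + (∫⁻ y in Icc (0 : ℝ) N, (u (s n - y) - m)) +
              ∫⁻ y in Ioi (N : ℝ), H (Ioi y) := by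
            rw [lintegral_add_left (hρ.const_mul m), lintegral_const_mul m hρ]
        _ ≤ _ := by
            simp only [htail]
            gcongr
            exact Icc_subset_Ici_self
    have hlim : Tendsto (fun N : ℕ => m * (∫⁻ y in Ici 0, H (Ioi y)) +
        ((∫⁻ y in Ici 0, H (Ioi y)) - ∫⁻ y in Icc (0 : ℝ) N, H (Ioi y))) atTop
        (𝓝 (m * (∫⁻ y in Ici 0, H (Ioi y)) + ((∫⁻ y in Ici 0, H (Ioi y)) -
          ∫⁻ y in Ici 0, H (Ioi y)))) :=
      (ENNReal.Tendsto.sub tendsto_const_nhds tendsto_setLIntegral_Icc_natCast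
        (Or.inl hmean)).const_add _
    have := ge_of_tendsto' hlim hT
    rw [tsub_self, add_zero] at this
    exact (ENNReal.div_le_iff_le_mul (Or.inl hmean0) (Or.inl hmean)).2 this
  · -- the upper bound
    obtain ⟨s, hus, hs⟩ := exists_seq_tendsto_limsup (f := (atTop : Filter ℝ)) (u := u)
    set M := limsup u atTop with hM
    have hM1 : M ≤ 1 := le_of_tendsto hus (Eventually.of_forall fun n => hu1 _)
    -- The mirror argument: now the deficit below the limsup vanishes in $L^1(H)$.
    have hconv : Tendsto (fun n => ∫⁻ y, (M - u (s n - y)) ∂H) atTop (𝓝 0) := by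
      have hmax : Tendsto (fun n => ∫⁻ y, max M (u (s n - y)) ∂H) atTop (𝓝 M) := by
        have : Tendsto (fun n => ∫⁻ y, max M (u (s n - y)) ∂H) atTop (𝓝 (∫⁻ _, M ∂H)) := by
          refine tendsto_lintegral_of_dominated_convergence (fun _ => 1)
            (fun n => measurable_const.max (hum _))
            (fun n => Eventually.of_forall fun y => max_le hM1 (hu1 _)) (by simp)
            (Eventually.of_forall fun y => ?_)
          refine tendsto_order.2 ⟨fun a ha => ?_, fun a ha => ?_⟩
          · exact Eventually.of_forall fun n => ha.trans_le (le_max_left _ _)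
          · have h := ((hshift y).comp hs).eventually (eventually_lt_of_limsup_lt (hM ▸ ha))
            filter_upwards [h] with n hn
            exact max_lt ha hn
        simpa using this
      have hu' : Tendsto (fun n => ∫⁻ y, u (s n - y) ∂H) atTop (𝓝 M) := by
        have h := ENNReal.Tendsto.sub hus (hk0.comp hs) (Or.inr ENNReal.zero_ne_top)
        rw [tsub_zero] at h
        refine h.congr' ?_
        filter_upwards [hs.eventually_ge_atTop 0] with n hn
        have hkn : k (s n) ≠ ⊤ := ne_top_of_le_ne_top ENNReal.one_ne_top
          ((heq _ hn ▸ le_self_add : k (s n) ≤ u (s n)).trans (hu1 _))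
        simp only [Function.comp]
        rw [heq _ hn, ENNReal.add_sub_cancel_left hkn]
      have h := ENNReal.Tendsto.sub hmax hu' (Or.inl (ne_top_of_le_ne_top ENNReal.one_ne_top hM1))
      rw [tsub_self] at h
      refine h.congr fun n => ?_
      rw [← lintegral_sub (hum _)]
      · refine lintegral_congr fun y => ?_
        rcases le_total M (u (s n - y)) with h | h
        · rw [max_eq_right h, tsub_self, tsub_eq_zero_of_le h]
        · rw [max_eq_left h]
      · refine ne_top_of_le_ne_top ENNReal.one_ne_top ?_
        calc _ ≤ ∫⁻ _, 1 ∂H := lintegral_mono fun y => hu1 _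
          _ = 1 := by simp
      · exact Eventually.of_forall fun y => le_max_right _ _
    -- No tail term is needed here: the part of the integrated equation beyond $N$ is nonnegative
    -- and can be dropped.
    have hT : ∀ N : ℕ, M * (∫⁻ y in Icc (0 : ℝ) N, H (Ioi y)) ≤ ∫⁻ y in Ici 0, k y := by
      intro N
      obtain ⟨δ, hδ, hδ', hle⟩ := hlow N
      have hz := tendsto_setLIntegral_of_tendsto_lintegral hδ hδ' hle hconv
      have hrhs := hz.const_add (∫⁻ y in Ici 0, k y)
      rw [add_zero] at hrhs
      refine ge_of_tendsto hrhs ?_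
      filter_upwards [hs.eventually_ge_atTop (N : ℝ)] with n hn
      have hm1 : Measurable fun y => u (s n - y) * H (Ioi y) := (hum _).mul hρ
      calc M * (∫⁻ y in Icc (0 : ℝ) N, H (Ioi y)) = ∫⁻ y in Icc (0 : ℝ) N, M * H (Ioi y) :=
            (lintegral_const_mul M hρ).symm
        _ ≤ ∫⁻ y in Icc (0 : ℝ) N, (u (s n - y) * H (Ioi y) + (M - u (s n - y))) := by
            refine lintegral_mono fun y => ?_
            calc M * H (Ioi y) ≤ (u (s n - y) + (M - u (s n - y))) * H (Ioi y) := by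
                    gcongr; exact le_add_tsub
                _ = u (s n - y) * H (Ioi y) + (M - u (s n - y)) * H (Ioi y) := add_mul _ _ _
                _ ≤ u (s n - y) * H (Ioi y) + (M - u (s n - y)) * 1 := by gcongr; exact hρ1 y
                _ = _ := by rw [mul_one]
        _ = (∫⁻ y in Icc (0 : ℝ) N, u (s n - y) * H (Ioi y)) +
              ∫⁻ y in Icc (0 : ℝ) N, (M - u (s n - y)) := lintegral_add_left hm1 _
        _ ≤ (∫⁻ y in Icc 0 (s n), u (s n - y) * H (Ioi y)) +
              ∫⁻ y in Icc (0 : ℝ) N, (M - u (s n - y)) := by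
            gcongr
        _ ≤ _ := by
            rw [setLIntegral_renewal hpos hu hk hu1 hu0 heq]
            gcongr
            exact Icc_subset_Ici_self
    have hlim := ENNReal.Tendsto.const_mul (a := M)
      (tendsto_setLIntegral_Icc_natCast (f := fun y => H (Ioi y))) (Or.inr
        (ne_top_of_le_ne_top ENNReal.one_ne_top hM1))
    have := le_of_tendsto' hlim hT
    exact (ENNReal.le_div_iff_mul_le (Or.inl hmean0) (Or.inl hmean)).2 this

end Renewal
end CylinderLight

namespace CylinderLight

/-! ### Wiener–Hopf factorization and the mean of the ladder height. -/

section WienerHopf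
open Set
open scoped ENNReal ComplexConjugate

variable {E : Type*}

theorem indicator_one_congr {α β : Type*} {S : Set α} {T : Set β} {a : α} {b : β}
    (h : a ∈ S ↔ b ∈ T) : S.indicator (1 : α → ℝ≥0∞) a = T.indicator (1 : β → ℝ≥0∞) b := by
  by_cases ha : a ∈ S
  · rw [indicator_of_mem ha, indicator_of_mem (h.1 ha)]; rfl
  · rw [indicator_of_notMem ha, indicator_of_notMem (mt h.2 ha)]

/-- The paths whose first `n` partial sums are nonpositive. -/
def staySet (g : E → ℝ) (n : ℕ) : Set (ℕ → E) := {x | ∀ i ≤ n, pathSum g i x ≤ 0}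

/-- The paths whose partial sums become positive for the first time at time `n + 1`. -/
def hitSet (g : E → ℝ) (n : ℕ) : Set (ℕ → E) := staySet g n ∩ {x | 0 < pathSum g (n + 1) x}

theorem staySet_zero (g : E → ℝ) : staySet g 0 = univ := by
  ext x; simp [staySet, pathSum_zero]

theorem staySet_succ (g : E → ℝ) (n : ℕ) :
    staySet g (n + 1) = staySet g n ∩ {x | pathSum g (n + 1) x ≤ 0} := by
  ext x
  simp only [staySet, mem_ofPred_eq, mem_inter_iff]
  constructor
  · exact fun h => ⟨fun i hi => h i (by omega), h _ le_rfl⟩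
  · rintro ⟨h1, h2⟩ i hi
    rcases Nat.lt_or_ge i (n + 1) with h | h
    · exact h1 i (by omega)
    · rwa [le_antisymm hi h]

theorem disjoint_hitSet (g : E → ℝ) : Pairwise (Function.onFun Disjoint (hitSet g)) := by
  have key : ∀ m n, m < n → Disjoint (hitSet g m) (hitSet g n) := fun m n h =>
    Set.disjoint_left.2 fun x hx hx' => not_lt.2 (hx'.1 (m + 1) h) hx.2
  intro m n hmn
  rcases lt_or_gt_of_ne hmn with h | h
  · exact key m n h
  · exact (key n m h).symm

variable [MeasurableSpace E]

theorem measurableSet_staySet {g : E → ℝ} (hg : Measurable g) (n : ℕ) :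
    MeasurableSet (staySet g n) := by
  have : staySet g n = ⋂ i ∈ Iic n, {x | pathSum g i x ≤ 0} := by ext x; simp [staySet]
  rw [this]
  exact MeasurableSet.biInter (to_countable _) fun i _ =>
    measurableSet_le (measurable_pathSum hg i) measurable_const

theorem measurableSet_hitSet {g : E → ℝ} (hg : Measurable g) (n : ℕ) :
    MeasurableSet (hitSet g n) :=
  (measurableSet_staySet hg n).inter
    (measurableSet_lt measurable_const (measurable_pathSum hg (n + 1)))

variable (ν : Measure E) [IsProbabilityMeasure ν] (g : E → ℝ)

/-- The law of the `n`-th partial sum on the event that the walk stayed nonpositive. -/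
noncomputable def stayLaw (n : ℕ) : Measure ℝ :=
  ((iidLaw ν).restrict (staySet g n)).map (pathSum g n)

/-- The law of the first positive partial sum on the event that it is reached at time `n + 1`. -/
noncomputable def hitLaw (n : ℕ) : Measure ℝ :=
  ((iidLaw ν).restrict (hitSet g n)).map (pathSum g (n + 1))

/-- The discounted occupation law before the first passage. -/
noncomputable def stayMeasure (r : ℝ) : Measure ℝ :=
  Measure.sum fun n => ENNReal.ofReal (r ^ n) • stayLaw ν g n

/-- The discounted ladder height law. -/
noncomputable def hitMeasure (r : ℝ) : Measure ℝ :=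
  Measure.sum fun n => ENNReal.ofReal (r ^ (n + 1)) • hitLaw ν g n

variable {g}

/-- A walk that has stayed nonpositive up to time `n` takes one more independent step, after which
it either is still nonpositive or has just become positive for the first time. -/
theorem stayLaw_conv (hg : Measurable g) (n : ℕ) :
    stayLaw ν g n ∗ ν.map g = stayLaw ν g (n + 1) + hitLaw ν g n := by
  ext A hA
  have hS := measurable_pathSum hg
  have hst := measurableSet_staySet hg n
  have hmA : Measurable (A.indicator (1 : ℝ → ℝ≥0∞)) := measurable_one.indicator hA
  have hm2 : Measurable fun p : (ℕ → E) × (ℕ → E) =>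
      A.indicator (1 : ℝ → ℝ≥0∞) (pathSum g n p.1 + g (p.2 0)) :=
    hmA.comp (((hS n).comp measurable_fst).add
      (hg.comp ((measurable_pi_apply 0).comp measurable_snd)))
  have hev : ν = (iidLaw ν).map (fun y => y 0) :=
    (measurePreserving_eval_infinitePi (fun _ : ℕ => ν) 0).map_eq.symm
  have hm3 : ∀ a : ℝ, Measurable fun b => A.indicator (1 : ℝ → ℝ≥0∞) (a + b) := fun a =>
    hmA.comp (measurable_const.add measurable_id)
  have hinner : ∀ a : ℝ, ∫⁻ b, A.indicator (1 : ℝ → ℝ≥0∞) (a + b) ∂(ν.map g) =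
      ∫⁻ y, A.indicator (1 : ℝ → ℝ≥0∞) (a + g (y 0)) ∂(iidLaw ν) := by
    intro a
    rw [lintegral_map (hm3 a) hg]
    conv_lhs => rw [hev]
    exact lintegral_map ((hm3 a).comp hg) (measurable_pi_apply 0)
  calc (stayLaw ν g n ∗ ν.map g) A
      = ∫⁻ z, A.indicator 1 z ∂(stayLaw ν g n ∗ ν.map g) := (lintegral_indicator_one hA).symm
    _ = ∫⁻ a, ∫⁻ y, A.indicator (1 : ℝ → ℝ≥0∞) (a + g (y 0)) ∂(iidLaw ν) ∂(stayLaw ν g n) := by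
        rw [Measure.lintegral_conv hmA]
        exact lintegral_congr hinner
    _ = ∫⁻ x in staySet g n, ∫⁻ y, A.indicator (1 : ℝ → ℝ≥0∞) (pathSum g n x + g (y 0))
          ∂(iidLaw ν) ∂(iidLaw ν) := by
        rw [stayLaw, lintegral_map _ (hS n)]
        have : Measurable fun p : ℝ × (ℕ → E) =>
            A.indicator (1 : ℝ → ℝ≥0∞) (p.1 + g (p.2 0)) :=
          hmA.comp (measurable_fst.add (hg.comp ((measurable_pi_apply 0).comp measurable_snd)))
        exact this.lintegral_prod_right'
    _ = ∫⁻ x, ∫⁻ y, (staySet g n).indicator 1 x *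
          A.indicator (1 : ℝ → ℝ≥0∞) (pathSum g n x + g (y 0)) ∂(iidLaw ν) ∂(iidLaw ν) := by
        rw [← lintegral_indicator hst]
        refine lintegral_congr fun x => ?_
        by_cases hx : x ∈ staySet g n <;> simp [hx]
    _ = ∫⁻ x, (staySet g n).indicator 1 x *
          A.indicator (1 : ℝ → ℝ≥0∞) (pathSum g n x + g (shiftPath n x 0)) ∂(iidLaw ν) := by
        refine (lintegral_shiftPath ν n (F := fun x y => (staySet g n).indicator 1 x *
          A.indicator (1 : ℝ → ℝ≥0∞) (pathSum g n x + g (y 0))) ?_ ?_).symm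
        · exact ((measurable_one.indicator hst).comp measurable_fst).mul hm2
        · intro x x' y h
          have h1 : x ∈ staySet g n ↔ x' ∈ staySet g n := by
            refine forall₂_congr fun i hi => ?_
            rw [pathSum_congr g fun j hj => h j (lt_of_lt_of_le hj hi)]
          have h2 : (staySet g n).indicator (1 : (ℕ → E) → ℝ≥0∞) x =
              (staySet g n).indicator 1 x' := indicator_one_congr h1
          simp only [h2]
          rw [pathSum_congr g h]
    _ = iidLaw ν (staySet g n ∩ pathSum g (n + 1) ⁻¹' A) := by
        rw [← lintegral_indicator_one (hst.inter (hS _ hA))]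
        refine lintegral_congr fun x => ?_
        rw [inter_indicator_one, Pi.mul_apply]
        simp only [shiftPath, add_zero, ← pathSum_succ]
        rfl
    _ = (stayLaw ν g (n + 1) + hitLaw ν g n) A := by
        rw [Measure.add_apply, stayLaw, hitLaw, Measure.map_apply (hS _) hA,
          Measure.map_apply (hS _) hA, Measure.restrict_apply (hS _ hA),
          Measure.restrict_apply (hS _ hA), ← measure_inter_add_sdiff _
          (measurableSet_le (hS (n + 1)) (measurable_const (a := (0 : ℝ)))), staySet_succ, hitSet]
        congr 2 <;> ext x <;> simp <;> tauto

theorem stayLaw_zero : stayLaw ν g 0 = Measure.dirac 0 := by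
  have : pathSum g 0 = fun _ => (0 : ℝ) := funext fun x => pathSum_zero g x
  rw [stayLaw, staySet_zero, Measure.restrict_univ, this, Measure.map_const]
  simp

theorem measure_univ_stayLaw_le (hg : Measurable g) (n : ℕ) : stayLaw ν g n univ ≤ 1 := by
  rw [stayLaw, Measure.map_apply (measurable_pathSum hg n) MeasurableSet.univ]
  simpa using prob_le_one

theorem measure_univ_hitLaw (hg : Measurable g) (n : ℕ) :
    hitLaw ν g n univ = iidLaw ν (hitSet g n) := by
  rw [hitLaw, Measure.map_apply (measurable_pathSum hg (n + 1)) MeasurableSet.univ]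
  simp

theorem stayLaw_Ioi (hg : Measurable g) (n : ℕ) : stayLaw ν g n (Ioi 0) = 0 := by
  rw [stayLaw, Measure.map_apply (measurable_pathSum hg n) measurableSet_Ioi,
    Measure.restrict_apply (measurable_pathSum hg n measurableSet_Ioi)]
  refine measure_mono_null (fun x hx => ?_) measure_empty
  exact absurd hx.1 (not_lt.2 (hx.2 n le_rfl))

theorem hitLaw_Iic (hg : Measurable g) (n : ℕ) : hitLaw ν g n (Iic 0) = 0 := by
  rw [hitLaw, Measure.map_apply (measurable_pathSum hg _) measurableSet_Iic,
    Measure.restrict_apply (measurable_pathSum hg _ measurableSet_Iic)]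
  refine measure_mono_null (fun x hx => ?_) measure_empty
  exact absurd (show pathSum g (n + 1) x ≤ 0 from hx.1) (not_le.2 hx.2.2)

/-- Convolution with an atomless step law has no atoms. Hence weak and strict ladder epochs agree
almost surely, and the occupation measure has exactly mass one at the origin, from time zero. -/
theorem stayLaw_singleton_zero (hg : Measurable g) (hat : ∀ a, ν.map g {a} = 0) (n : ℕ) :
    stayLaw ν g (n + 1) {0} = 0 := by
  have h : stayLaw ν g (n + 1) {0} ≤ (stayLaw ν g n ∗ ν.map g) {0} := by
    rw [stayLaw_conv ν hg]; exact le_self_add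
  refine le_antisymm (h.trans ?_) zero_le
  rw [← lintegral_indicator_one (measurableSet_singleton 0),
    Measure.lintegral_conv (measurable_one.indicator (measurableSet_singleton 0))]
  refine le_of_eq ?_
  refine (lintegral_congr fun x => ?_).trans lintegral_zero
  have : (fun y => ({0} : Set ℝ).indicator (1 : ℝ → ℝ≥0∞) (x + y)) = ({-x} : Set ℝ).indicator 1 := by
    ext y
    simp [indicator, add_eq_zero_iff_neg_eq, eq_comm]
  rw [this, lintegral_indicator_one (measurableSet_singleton _), hat]

theorem tsum_measure_hitSet_le (hg : Measurable g) :
    ∑' n, iidLaw ν (hitSet g n) ≤ 1 := by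
  rw [← measure_iUnion (disjoint_hitSet g) (measurableSet_hitSet hg)]
  exact prob_le_one

theorem isFiniteMeasure_stayMeasure (hg : Measurable g) {r : ℝ} (h0 : 0 ≤ r) (h1 : r < 1) :
    IsFiniteMeasure (stayMeasure ν g r) := by
  refine ⟨?_⟩
  rw [stayMeasure, Measure.sum_apply _ MeasurableSet.univ]
  calc ∑' n, (ENNReal.ofReal (r ^ n) • stayLaw ν g n) univ
      ≤ ∑' n, ENNReal.ofReal (r ^ n) := by
        refine ENNReal.tsum_le_tsum fun n => ?_
        rw [Measure.smul_apply, smul_eq_mul]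
        exact mul_le_of_le_one_right zero_le (measure_univ_stayLaw_le ν hg n)
    _ < ⊤ := by
        rw [← ENNReal.ofReal_tsum_of_nonneg (fun n => pow_nonneg h0 n)
          (summable_geometric_of_lt_one h0 h1)]
        exact ENNReal.ofReal_lt_top

theorem measure_univ_hitMeasure_le (hg : Measurable g) {r : ℝ} (h0 : 0 ≤ r) (h1 : r ≤ 1) :
    hitMeasure ν g r univ ≤ 1 := by
  rw [hitMeasure, Measure.sum_apply _ MeasurableSet.univ]
  refine le_trans (ENNReal.tsum_le_tsum fun n => ?_) (tsum_measure_hitSet_le ν hg)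
  rw [Measure.smul_apply, smul_eq_mul, measure_univ_hitLaw ν hg]
  refine mul_le_of_le_one_left zero_le ?_
  rw [← ENNReal.ofReal_one]
  exact ENNReal.ofReal_le_ofReal (pow_le_one₀ h0 h1)

theorem isFiniteMeasure_hitMeasure (hg : Measurable g) {r : ℝ} (h0 : 0 ≤ r) (h1 : r ≤ 1) :
    IsFiniteMeasure (hitMeasure ν g r) :=
  ⟨(measure_univ_hitMeasure_le ν hg h0 h1).trans_lt ENNReal.one_lt_top⟩

theorem hitMeasure_Iic (hg : Measurable g) (r : ℝ) : hitMeasure ν g r (Iic 0) = 0 := by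
  rw [hitMeasure, Measure.sum_apply _ measurableSet_Iic]
  simp [hitLaw_Iic ν hg]

theorem stayMeasure_Ioi (hg : Measurable g) (r : ℝ) : stayMeasure ν g r (Ioi 0) = 0 := by
  rw [stayMeasure, Measure.sum_apply _ measurableSet_Ioi]
  simp [stayLaw_Ioi ν hg]

theorem stayMeasure_singleton_zero (hg : Measurable g) (hat : ∀ a, ν.map g {a} = 0) (r : ℝ) :
    stayMeasure ν g r {0} = 1 := by
  rw [stayMeasure, Measure.sum_apply _ (measurableSet_singleton 0), tsum_eq_single 0]
  · simp [stayLaw_zero]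
  · intro n hn
    obtain ⟨m, rfl⟩ := Nat.exists_eq_succ_of_ne_zero hn
    simp [stayLaw_singleton_zero ν hg hat m]

theorem hasSum_charFun_sum {L : ℕ → Measure ℝ} {w : ℕ → ℝ} (hw : ∀ n, 0 ≤ w n)
    (hfin : IsFiniteMeasure (Measure.sum fun n => ENNReal.ofReal (w n) • L n)) (t : ℝ) :
    HasSum (fun n => (w n : ℂ) * charFun (L n) t)
      (charFun (Measure.sum fun n => ENNReal.ofReal (w n) • L n) t) := by
  have hint : Integrable (fun x : ℝ => Complex.exp (t * x * Complex.I))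
      (Measure.sum fun n => ENNReal.ofReal (w n) • L n) := by
    refine Integrable.of_bound (by fun_prop) 1 (Eventually.of_forall fun x => ?_)
    rw [← Complex.ofReal_mul, Complex.norm_exp_ofReal_mul_I]
  have h := hasSum_integral_measure hint
  simp only [charFun_apply_real]
  simpa only [integral_smul_measure, ENNReal.toReal_ofReal (hw _), Complex.real_smul] using h

theorem charFun_add_measure (μ₁ μ₂ : Measure ℝ) [IsFiniteMeasure μ₁] [IsFiniteMeasure μ₂] (t : ℝ) :
    charFun (μ₁ + μ₂) t = charFun μ₁ t + charFun μ₂ t := by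
  have hint : ∀ μ : Measure ℝ, IsFiniteMeasure μ →
      Integrable (fun x : ℝ => Complex.exp (t * x * Complex.I)) μ := by
    intro μ _
    refine Integrable.of_bound (by fun_prop) 1 (Eventually.of_forall fun x => ?_)
    rw [← Complex.ofReal_mul, Complex.norm_exp_ofReal_mul_I]
  simp only [charFun_apply_real]
  exact integral_add_measure (hint μ₁ inferInstance) (hint μ₂ inferInstance)

theorem charFun_map_neg (μ : Measure ℝ) (t : ℝ) :
    charFun (μ.map (fun x => -x)) t = conj (charFun μ t) := by
  have h := charFun_map_mul (μ := μ) (-1) t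
  rw [neg_one_mul, charFun_neg] at h
  simpa using h

instance isFiniteMeasure_stayLaw (n : ℕ) : IsFiniteMeasure (stayLaw ν g n) := by
  unfold stayLaw; infer_instance

instance isFiniteMeasure_hitLaw (n : ℕ) : IsFiniteMeasure (hitLaw ν g n) := by
  unfold hitLaw; infer_instance

/-- The one-step identity `stayLaw_conv`, weighted by $r^{n+1}$ and summed over $n$, telescopes; the
surviving $1$ is the mass at time zero. Discounting by $r<1$ keeps the occupation measure finite. -/
theorem one_sub_mul_charFun_stayMeasure (hg : Measurable g) {r : ℝ} (h0 : 0 ≤ r) (h1 : r < 1)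
    (t : ℝ) :
    (1 - r * charFun (ν.map g) t) * charFun (stayMeasure ν g r) t =
      1 - charFun (hitMeasure ν g r) t := by
  have hs : HasSum (fun n => ((r ^ n : ℝ) : ℂ) * charFun (stayLaw ν g n) t)
      (charFun (stayMeasure ν g r) t) :=
    hasSum_charFun_sum (L := stayLaw ν g) (w := fun n => r ^ n) (fun n => pow_nonneg h0 n)
      (isFiniteMeasure_stayMeasure ν hg h0 h1) t
  have hh : HasSum (fun n => ((r ^ (n + 1) : ℝ) : ℂ) * charFun (hitLaw ν g n) t)
      (charFun (hitMeasure ν g r) t) :=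
    hasSum_charFun_sum (L := hitLaw ν g) (w := fun n => r ^ (n + 1))
      (fun n => pow_nonneg h0 (n + 1)) (isFiniteMeasure_hitMeasure ν hg h0 h1.le) t
  have hc : ∀ n, charFun (stayLaw ν g n) t * charFun (ν.map g) t =
      charFun (stayLaw ν g (n + 1)) t + charFun (hitLaw ν g n) t := fun n => by
    rw [← charFun_conv, stayLaw_conv ν hg, charFun_add_measure]
  have hs1 := (hasSum_nat_add_iff' 1).2 hs
  simp only [Finset.range_one, Finset.sum_singleton, pow_zero, stayLaw_zero, charFun_dirac,
    Complex.ofReal_one, one_mul] at hs1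
  have h2 := hs.mul_left (r * charFun (ν.map g) t)
  have h3 := (hs1.add hh).unique (h2.congr_fun fun n => ?_)
  · simp at h3
    linear_combination h3
  · have := hc n
    push_cast
    linear_combination -(r : ℂ) ^ (n + 1) * this

/-- Write $G$ for the occupation measure, $H$ for the ladder measure, and $G^-,H^-$ for their
reflections. Symmetry makes $\hat G(1-\overline{\hat H})$ real, which says $G+G^-*H=G^-+G*H^-$. On
the negative half-line $G^-$ and $G^-*H$ have no mass, so $G=G*H^-$ there. At the origin $G$ has
mass one and $G*H^-$ none, and both vanish on the positive half-line. Comparing supports thus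
replaces analytic continuation. -/
theorem stayMeasure_eq (hg : Measurable g) (hsym : ∀ t, conj (charFun (ν.map g) t) =
    charFun (ν.map g) t) (hat : ∀ a, ν.map g {a} = 0) {r : ℝ} (h0 : 0 ≤ r) (h1 : r < 1) :
    stayMeasure ν g r = Measure.dirac 0 +
      stayMeasure ν g r ∗ (hitMeasure ν g r).map (fun x => -x) := by
  have := isFiniteMeasure_stayMeasure ν hg h0 h1
  have := isFiniteMeasure_hitMeasure ν hg h0 h1.le
  have : IsProbabilityMeasure (ν.map g) := Measure.isProbabilityMeasure_map hg.aemeasurable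
  set G := stayMeasure ν g r with hG
  set H := hitMeasure ν g r with hH
  have hbal : G + G.map (fun x => -x) ∗ H = G.map (fun x => -x) + G ∗ H.map (fun x => -x) := by
    refine Measure.ext_of_charFun (funext fun t => ?_)
    rw [charFun_add_measure, charFun_add_measure, charFun_conv, charFun_conv, charFun_map_neg,
      charFun_map_neg]
    have e1 := one_sub_mul_charFun_stayMeasure ν hg h0 h1 t
    have e2 := congrArg conj e1
    simp only [map_mul, map_sub, map_one, hsym, Complex.conj_ofReal] at e2
    rw [← hG, ← hH] at e1 e2
    -- A characteristic function has modulus at most one and $r<1$, so the factor can be cancelled.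
    have hne : (1 - r * charFun (ν.map g) t) ≠ 0 := by
      intro h
      have h' : (r : ℂ) * charFun (ν.map g) t = 1 := (sub_eq_zero.1 h).symm
      have hn := congrArg norm h'
      rw [norm_mul, norm_one, Complex.norm_real, Real.norm_eq_abs, abs_of_nonneg h0] at hn
      have := norm_charFun_le_one (μ := ν.map g) t
      nlinarith
    refine mul_left_cancel₀ hne ?_
    linear_combination (1 - conj (charFun H t)) * e1 - (1 - charFun H t) * e2
  have hGpos : G (Ioi 0) = 0 := stayMeasure_Ioi ν hg r
  have hG0 : G {0} = 1 := stayMeasure_singleton_zero ν hg hat r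
  have hHneg : H (Iic 0) = 0 := hitMeasure_Iic ν hg r
  have hGae : ∀ᵐ x ∂G, x ≤ 0 := by rw [ae_iff]; simpa [Ioi] using hGpos
  have hHae : ∀ᵐ x ∂H, 0 < x := by rw [ae_iff]; simpa [Iic] using hHneg
  have hnG : (G.map (fun x => -x)) (Iio 0) = 0 := by
    rw [Measure.map_apply measurable_neg measurableSet_Iio]; simpa using hGpos
  have hnegconv : (G ∗ H.map (fun x => -x)) (Ici 0) = 0 := by
    rw [← lintegral_indicator_one measurableSet_Ici,
      Measure.lintegral_conv (measurable_one.indicator measurableSet_Ici)]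
    refine (lintegral_congr_ae ?_).trans lintegral_zero
    filter_upwards [hGae] with x hx
    refine (lintegral_map (f := fun y => (Ici (0 : ℝ)).indicator (1 : ℝ → ℝ≥0∞) (x + y))
      ((measurable_one.indicator measurableSet_Ici).comp
      (measurable_const.add measurable_id)) measurable_neg).trans ?_
    refine (lintegral_congr_ae ?_).trans lintegral_zero
    filter_upwards [hHae] with y hy
    exact indicator_of_notMem (by simp only [mem_Ici, not_le]; linarith) _
  have hposconv : (G.map (fun x => -x) ∗ H) (Iic 0) = 0 := by
    rw [← lintegral_indicator_one measurableSet_Iic,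
      Measure.lintegral_conv (measurable_one.indicator measurableSet_Iic),
      lintegral_map _ measurable_neg]
    · refine (lintegral_congr_ae ?_).trans lintegral_zero
      filter_upwards [hGae] with x hx
      refine (lintegral_congr_ae ?_).trans lintegral_zero
      filter_upwards [hHae] with y hy
      exact indicator_of_notMem (by simp only [mem_Iic, not_le]; linarith) _
    · exact ((measurable_one.indicator measurableSet_Iic).comp
        measurable_add).lintegral_prod_right'
  ext A hA
  have hsplit : ∀ μ : Measure ℝ, μ A = μ (A ∩ Iio 0) + μ (A ∩ {0}) + μ (A ∩ Ioi 0) := by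
    intro μ
    rw [← measure_inter_add_sdiff A (measurableSet_Iic (a := (0 : ℝ))),
      ← measure_inter_add_sdiff (A ∩ Iic 0) (measurableSet_Iio (a := (0 : ℝ)))]
    congr 2 <;> congr 1
    · ext x
      exact ⟨fun h => ⟨h.1.1, h.2⟩, fun h => ⟨⟨h.1, Iio_subset_Iic_self h.2⟩, h.2⟩⟩
    · ext x
      exact ⟨fun h => ⟨h.1.1, le_antisymm h.1.2 (not_lt.1 h.2)⟩,
        fun h => ⟨⟨h.1, le_of_eq h.2⟩, not_lt.2 (le_of_eq h.2.symm)⟩⟩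
    · ext x
      exact ⟨fun h => ⟨h.1, mem_Ioi.2 (not_le.1 (show ¬ x ≤ 0 from h.2))⟩,
        fun h => ⟨h.1, fun h' => not_lt.2 h' (mem_Ioi.1 h.2)⟩⟩
  have hneg : G (A ∩ Iio 0) = (G ∗ H.map (fun x => -x)) (A ∩ Iio 0) := by
    have h := congrArg (fun μ : Measure ℝ => μ (A ∩ Iio 0)) hbal
    simp only [Measure.add_apply] at h
    rw [measure_mono_null (inter_subset_right.trans Iio_subset_Iic_self) hposconv,
      measure_mono_null inter_subset_right hnG, add_zero, zero_add] at h
    exact h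
  rw [hsplit G, hneg, measure_mono_null inter_subset_right hGpos, Measure.add_apply,
    hsplit (G ∗ H.map (fun x => -x)),
    measure_mono_null (inter_subset_right.trans Ioi_subset_Ici_self) hnegconv,
    measure_mono_null (μ := G ∗ H.map (fun x => -x)) (s := A ∩ {0}) (t := Ici 0) (by
      rintro x ⟨_, rfl⟩; exact self_mem_Ici) hnegconv, Measure.dirac_apply' _ hA, add_zero, add_zero,
    add_zero, add_comm]
  congr 1
  by_cases h : (0 : ℝ) ∈ A
  · rw [inter_eq_right.2 (singleton_subset_iff.2 h), hG0, indicator_of_mem h]; rfl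
  · rw [inter_singleton_eq_empty.2 h, measure_empty, indicator_of_notMem h]

/-- The Wiener–Hopf factorization of a symmetric walk without atoms, at discount `r`. -/
theorem one_sub_mul_charFun_eq (hg : Measurable g) (hsym : ∀ t, conj (charFun (ν.map g) t) =
    charFun (ν.map g) t) (hat : ∀ a, ν.map g {a} = 0) {r : ℝ} (h0 : 0 ≤ r) (h1 : r < 1) (t : ℝ) :
    1 - r * charFun (ν.map g) t =
      (1 - charFun (hitMeasure ν g r) t) * conj (1 - charFun (hitMeasure ν g r) t) := by
  have := isFiniteMeasure_stayMeasure ν hg h0 h1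
  have := isFiniteMeasure_hitMeasure ν hg h0 h1.le
  have h := congrArg (fun μ => charFun μ t) (stayMeasure_eq ν hg hsym hat h0 h1)
  rw [charFun_add_measure, charFun_conv, charFun_map_neg, charFun_dirac] at h
  simp at h
  have e1 := one_sub_mul_charFun_stayMeasure ν hg h0 h1 t
  rw [map_sub, map_one]
  linear_combination (1 - conj (charFun (hitMeasure ν g r) t)) * e1 -
    (1 - r * charFun (ν.map g) t) * h

/-- The Wiener–Hopf factorization of a symmetric walk without atoms. -/
theorem one_sub_charFun_eq (hg : Measurable g) (hsym : ∀ t, conj (charFun (ν.map g) t) =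
    charFun (ν.map g) t) (hat : ∀ a, ν.map g {a} = 0) (t : ℝ) :
    1 - charFun (ν.map g) t =
      (1 - charFun (hitMeasure ν g 1) t) * conj (1 - charFun (hitMeasure ν g 1) t) := by
  have hsum : Summable fun n => (iidLaw ν).real (hitSet g n) := by
    refine ENNReal.summable_toReal (ne_top_of_le_ne_top ENNReal.one_ne_top
      (tsum_measure_hitSet_le ν hg))
  have hval : ∀ r : ℝ, 0 ≤ r → r ≤ 1 → charFun (hitMeasure ν g r) t =
      ∑' n, ((r ^ (n + 1) : ℝ) : ℂ) * charFun (hitLaw ν g n) t := by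
    intro r h0 h1
    exact (hasSum_charFun_sum (L := hitLaw ν g) (w := fun n => r ^ (n + 1))
      (fun n => pow_nonneg h0 (n + 1)) (isFiniteMeasure_hitMeasure ν hg h0 h1) t).tsum_eq.symm
  -- Abel's limit by dominated convergence: the $n$-th term is bounded by the probability of `hitSet
  -- g n`, summable because these events are disjoint.
  have hlim : Tendsto (fun r : ℝ => charFun (hitMeasure ν g r) t) (𝓝[<] 1)
      (𝓝 (charFun (hitMeasure ν g 1) t)) := by
    have hev : ∀ᶠ r : ℝ in 𝓝[<] 1, 0 ≤ r ∧ r ≤ 1 := by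
      filter_upwards [Ioo_mem_nhdsLT (zero_lt_one (α := ℝ))] with r hr
      exact ⟨hr.1.le, hr.2.le⟩
    rw [hval 1 zero_le_one le_rfl]
    refine Tendsto.congr' (hev.mono fun r hr => (hval r hr.1 hr.2).symm) ?_
    refine tendsto_tsum_of_dominated_convergence hsum (fun n => ?_) ?_
    · refine Tendsto.mul_const _ ?_
      have : Continuous fun r : ℝ => ((r ^ (n + 1) : ℝ) : ℂ) := by fun_prop
      exact this.continuousWithinAt
    · filter_upwards [hev] with r hr n
      rw [norm_mul, Complex.norm_real, Real.norm_eq_abs, abs_of_nonneg (pow_nonneg hr.1 _)]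
      have h2 : ‖charFun (hitLaw ν g n) t‖ ≤ (iidLaw ν).real (hitSet g n) := by
        refine (norm_charFun_le t).trans (le_of_eq ?_)
        rw [measureReal_def, measure_univ_hitLaw ν hg, measureReal_def]
      exact (mul_le_of_le_one_left (norm_nonneg _) (pow_le_one₀ hr.1 hr.2)).trans h2
  have hl : Tendsto (fun r : ℝ => 1 - (r : ℂ) * charFun (ν.map g) t) (𝓝[<] 1)
      (𝓝 (1 - ((1 : ℝ) : ℂ) * charFun (ν.map g) t)) := by
    have : Continuous fun r : ℝ => 1 - (r : ℂ) * charFun (ν.map g) t := by fun_prop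
    exact this.continuousWithinAt
  have hr := (hlim.const_sub 1).mul ((Complex.continuous_conj.tendsto _).comp (hlim.const_sub 1))
  have := tendsto_nhds_unique (hl.congr' ?_) hr
  · simpa using this
  · filter_upwards [Ioo_mem_nhdsLT (zero_lt_one (α := ℝ))] with r hr
    exact one_sub_mul_charFun_eq ν hg hsym hat hr.1.le hr.2 t

/-- At $t=0$ the left side of the factorization is zero, so the squared modulus of $1-H(\mathbb R)$
is zero: the walk almost surely becomes positive. -/
theorem isProbabilityMeasure_hitMeasure (hg : Measurable g) (hsym : ∀ t, conj (charFun (ν.map g) t) =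
    charFun (ν.map g) t) (hat : ∀ a, ν.map g {a} = 0) :
    IsProbabilityMeasure (hitMeasure ν g 1) := by
  have := isFiniteMeasure_hitMeasure ν hg zero_le_one le_rfl
  have : IsProbabilityMeasure (ν.map g) := Measure.isProbabilityMeasure_map hg.aemeasurable
  have h := one_sub_charFun_eq ν hg hsym hat 0
  rw [charFun_zero, charFun_zero, Complex.mul_conj, Complex.normSq_eq_norm_sq] at h
  simp at h
  refine ⟨?_⟩
  rw [← ENNReal.ofReal_toReal (measure_ne_top (hitMeasure ν g 1) univ), ← measureReal_def]
  have h2 : (1 : ℂ) - ((hitMeasure ν g 1).real univ : ℝ) = 0 := by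
    have h3 : ‖(1 : ℂ) - ((hitMeasure ν g 1).real univ : ℝ)‖ ^ 2 = 0 := by exact_mod_cast h.symm
    exact norm_eq_zero.1 (pow_eq_zero_iff two_ne_zero |>.1 h3)
  have h3 : (hitMeasure ν g 1).real univ = 1 := by
    exact_mod_cast (sub_eq_zero.1 h2).symm
  rw [h3, ENNReal.ofReal_one]

/-- The squared imaginary part of $\varphi_H(t)$ is at most $|1-\varphi_H(t)|^2=1-\mathbb
E\cos(tX)\le t^2\sigma^2/2$. So the sine transform of $H$ is at most $t\sqrt{\sigma^2/2}$, and
`lintegral_le_of_integral_sin_le` converts this into the bound on the mean. -/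
theorem lintegral_hitMeasure_le (hg : Measurable g) (hsym : ∀ t, conj (charFun (ν.map g) t) =
    charFun (ν.map g) t) (hat : ∀ a, ν.map g {a} = 0) {σ2 : ℝ}
    (hσi : Integrable (fun e => g e ^ 2) ν) (hσ : ∫ e, g e ^ 2 ∂ν ≤ σ2) :
    ∫⁻ y, ENNReal.ofReal y ∂(hitMeasure ν g 1) ≤ ENNReal.ofReal √(σ2 / 2) := by
  have := isProbabilityMeasure_hitMeasure ν hg hsym hat
  have hσ0 : 0 ≤ σ2 := (integral_nonneg fun e => sq_nonneg _).trans hσ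
  refine lintegral_le_of_integral_sin_le _
    (measure_mono_null Iio_subset_Iic_self (hitMeasure_Iic ν hg 1)) fun t ht => ?_
  have hint : ∀ (μ : Measure ℝ) [IsFiniteMeasure μ],
      Integrable (fun x : ℝ => Complex.exp (t * x * Complex.I)) μ := by
    intro μ _
    refine Integrable.of_bound (by fun_prop) 1 (Eventually.of_forall fun x => ?_)
    rw [← Complex.ofReal_mul, Complex.norm_exp_ofReal_mul_I]
  have him : (charFun (hitMeasure ν g 1) t).im = ∫ x, Real.sin (t * x) ∂(hitMeasure ν g 1) := by
    rw [charFun_apply_real]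
    have := Complex.imCLM.integral_comp_comm (hint (hitMeasure ν g 1))
    simp only [Complex.imCLM_apply] at this
    rw [← this]
    refine integral_congr_ae (Eventually.of_forall fun x => ?_)
    simp only [← Complex.ofReal_mul, Complex.exp_ofReal_mul_I_im]
  have hre : (charFun (ν.map g) t).re = ∫ e, Real.cos (t * g e) ∂ν := by
    rw [charFun_apply_real]
    have := Complex.reCLM.integral_comp_comm (hint (ν.map g))
    simp only [Complex.reCLM_apply] at this
    rw [← this, integral_map hg.aemeasurable (by fun_prop)]
    refine integral_congr_ae (Eventually.of_forall fun x => ?_)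
    simp only [← Complex.ofReal_mul, Complex.exp_ofReal_mul_I_re]
  have h := one_sub_charFun_eq ν hg hsym hat t
  rw [Complex.mul_conj] at h
  have h' := congrArg Complex.re h
  simp only [Complex.sub_re, Complex.one_re, Complex.ofReal_re, Complex.normSq_apply,
    Complex.sub_im, Complex.one_im, zero_sub] at h'
  have hcos : 1 - ∫ e, Real.cos (t * g e) ∂ν ≤ t ^ 2 / 2 * σ2 := by
    have hic : Integrable (fun e => Real.cos (t * g e)) ν :=
      Integrable.of_bound (by fun_prop) 1 (Eventually.of_forall fun x => by
        simpa using Real.abs_cos_le_one _)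
    calc 1 - ∫ e, Real.cos (t * g e) ∂ν = ∫ e, (1 - Real.cos (t * g e)) ∂ν := by
          rw [integral_sub (integrable_const _) hic]; simp
      _ ≤ ∫ e, t ^ 2 / 2 * g e ^ 2 ∂ν := by
          refine integral_mono ((integrable_const _).sub hic) (hσi.const_mul _) fun e => ?_
          have := Real.one_sub_sq_div_two_le_cos (x := t * g e)
          simp only
          nlinarith
      _ ≤ t ^ 2 / 2 * σ2 := by
          rw [integral_const_mul]; gcongr
  rw [← him]
  refine (le_abs_self _).trans (abs_le_of_sq_le_sq ?_ (by positivity))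
  rw [mul_pow, Real.sq_sqrt (by positivity)]
  rw [hre] at h'
  nlinarith [mul_self_nonneg (1 - (charFun (hitMeasure ν g 1) t).re)]

end WienerHopf
end CylinderLight

namespace CylinderLight

/-! ### First passage over a high level and its renewal equation. -/

section Passage
open Set
open scoped ENNReal ComplexConjugate

variable {E : Type*}

/-- The paths of partial sums which first exceed `s` in a step `e` whose starting level `a` satisfies
`(s - a, e) ∈ B`. -/
def exitSet (g : E → ℝ) (B : Set (ℝ × E)) (s : ℝ) : Set (ℕ → E) :=
  {x | ∃ n, (∀ i ≤ n, pathSum g i x ≤ s) ∧ s < pathSum g (n + 1) x ∧ (s - pathSum g n x, x n) ∈ B}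

theorem exitSet_of_neg (g : E → ℝ) (B : Set (ℝ × E)) {s : ℝ} (hs : s < 0) :
    exitSet g B s = ∅ := by
  refine eq_empty_of_forall_notMem fun x ⟨n, h, _⟩ => ?_
  have := h 0 (Nat.zero_le n)
  rw [pathSum_zero] at this
  linarith

/-- If the first ladder height jumps over `s`, then the ladder step itself is the crossing step,
since no earlier partial sum is positive. -/
theorem mem_exitSet_of_lt {g : E → ℝ} {B : Set (ℝ × E)} {s : ℝ} (hs : 0 ≤ s) {n : ℕ} {x : ℕ → E}
    (hx : x ∈ hitSet g n) (hlt : s < pathSum g (n + 1) x) :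
    x ∈ exitSet g B s ↔ (s - pathSum g n x, x n) ∈ B := by
  constructor
  · rintro ⟨m, h1, h2, h3⟩
    have hmn : m = n := by
      rcases lt_trichotomy m n with h | h | h
      · exact absurd h2 (not_lt.2 ((hx.1 (m + 1) h).trans hs))
      · exact h
      · exact absurd hlt (not_lt.2 (h1 (n + 1) h))
    exact hmn ▸ h3
  · exact fun h => ⟨n, fun i hi => (hx.1 i hi).trans hs, hlt, h⟩

/-- If the first ladder height stays below `s`, the crossing occurs later and restarts from the
ladder point; distances to the level are unchanged when path and level are shifted together. -/
theorem mem_exitSet_of_le {g : E → ℝ} {B : Set (ℝ × E)} {s : ℝ} (hs : 0 ≤ s) {n : ℕ} {x : ℕ → E}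
    (hx : x ∈ hitSet g n) (hle : pathSum g (n + 1) x ≤ s) :
    x ∈ exitSet g B s ↔ shiftPath (n + 1) x ∈ exitSet g B (s - pathSum g (n + 1) x) := by
  constructor
  · rintro ⟨m, h1, h2, h3⟩
    have hmn : n + 1 ≤ m := by
      by_contra h
      rcases Nat.lt_or_ge m n with h' | h'
      · exact absurd h2 (not_lt.2 ((hx.1 (m + 1) h').trans hs))
      · have : m = n := by omega
        subst this
        exact absurd h2 (not_lt.2 hle)
    obtain ⟨j, rfl⟩ := Nat.exists_eq_add_of_le hmn
    refine ⟨j, fun i hi => ?_, ?_, ?_⟩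
    · have := h1 (n + 1 + i) (by omega)
      rw [pathSum_add] at this
      linarith
    · rw [add_assoc, pathSum_add] at h2
      linarith
    · rw [pathSum_add] at h3
      rw [sub_sub]
      exact h3
  · rintro ⟨j, h1, h2, h3⟩
    refine ⟨n + 1 + j, fun i hi => ?_, ?_, ?_⟩
    · rcases Nat.lt_or_ge i (n + 1) with h | h
      · exact (hx.1 i (by omega)).trans hs
      · obtain ⟨l, rfl⟩ := Nat.exists_eq_add_of_le h
        have := h1 l (by omega)
        rw [pathSum_add]
        linarith
    · rw [add_assoc, pathSum_add]
      linarith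
    · rw [pathSum_add, ← sub_sub]
      exact h3

variable [MeasurableSpace E]

theorem measurableSet_exitSet {g : E → ℝ} (hg : Measurable g) {B : Set (ℝ × E)}
    (hB : MeasurableSet B) :
    MeasurableSet {p : ℝ × (ℕ → E) | p.2 ∈ exitSet g B p.1} := by
  have hS : ∀ n, Measurable fun p : ℝ × (ℕ → E) => pathSum g n p.2 := fun n =>
    (measurable_pathSum hg n).comp measurable_snd
  have : {p : ℝ × (ℕ → E) | p.2 ∈ exitSet g B p.1} = ⋃ n,
      ((⋂ i ∈ Iic n, {p | pathSum g i p.2 ≤ p.1}) ∩ ({p | p.1 < pathSum g (n + 1) p.2} ∩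
        (fun p : ℝ × (ℕ → E) => (p.1 - pathSum g n p.2, p.2 n)) ⁻¹' B)) := by
    ext p; simp [exitSet]
  rw [this]
  refine MeasurableSet.iUnion fun n => MeasurableSet.inter ?_ (MeasurableSet.inter ?_ ?_)
  · exact MeasurableSet.biInter (to_countable _) fun i _ =>
      measurableSet_le (hS i) measurable_fst
  · exact measurableSet_lt measurable_fst (hS (n + 1))
  · exact ((measurable_fst.sub (hS n)).prodMk
      ((measurable_pi_apply n).comp measurable_snd)) hB

/-- The paths whose first positive partial sum exceeds `s`, and does so as `B` prescribes. -/
def ladderExitSet (g : E → ℝ) (B : Set (ℝ × E)) (n : ℕ) (s : ℝ) : Set (ℕ → E) :=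
  {x | x ∈ hitSet g n ∧ s < pathSum g (n + 1) x ∧ (s - pathSum g n x, x n) ∈ B}

theorem measurableSet_ladderExitSet {g : E → ℝ} (hg : Measurable g) {B : Set (ℝ × E)}
    (hB : MeasurableSet B) (n : ℕ) :
    MeasurableSet {p : ℝ × (ℕ → E) | p.2 ∈ ladderExitSet g B n p.1} := by
  have hS : ∀ n, Measurable fun p : ℝ × (ℕ → E) => pathSum g n p.2 := fun n =>
    (measurable_pathSum hg n).comp measurable_snd
  exact (measurable_snd (measurableSet_hitSet hg n)).inter
    ((measurableSet_lt measurable_fst (hS (n + 1))).inter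
    (((measurable_fst.sub (hS n)).prodMk ((measurable_pi_apply n).comp measurable_snd)) hB))

variable (ν : Measure E) [IsProbabilityMeasure ν] (g : E → ℝ)

/-- The probability that the first ladder height exceeds `s`, and does so as `B` prescribes. -/
noncomputable def ladderExitProb (B : Set (ℝ × E)) (s : ℝ) : ℝ≥0∞ :=
  ∑' n, iidLaw ν (ladderExitSet g B n s)

variable {g}

theorem measurable_exitProb (hg : Measurable g) {B : Set (ℝ × E)} (hB : MeasurableSet B) :
    Measurable fun s => iidLaw ν (exitSet g B s) :=
  measurable_measure_prodMk_left (measurableSet_exitSet hg hB)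

theorem measurable_ladderExitProb (hg : Measurable g) {B : Set (ℝ × E)} (hB : MeasurableSet B) :
    Measurable (ladderExitProb ν g B) :=
  Measurable.tsum fun n =>
    measurable_measure_prodMk_left (measurableSet_ladderExitSet hg hB n)

theorem lintegral_hitMeasure_one (f : ℝ → ℝ≥0∞) :
    ∫⁻ y, f y ∂(hitMeasure ν g 1) = ∑' n, ∫⁻ y, f y ∂(hitLaw ν g n) := by
  simp [hitMeasure, lintegral_sum_measure]

theorem hitMeasure_one_apply (hg : Measurable g) {A : Set ℝ} (hA : MeasurableSet A) :
    hitMeasure ν g 1 A = ∑' n, iidLaw ν (hitSet g n ∩ pathSum g (n + 1) ⁻¹' A) := by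
  rw [hitMeasure, Measure.sum_apply _ hA]
  refine tsum_congr fun n => ?_
  have hS := measurable_pathSum hg (n + 1)
  rw [one_pow, ENNReal.ofReal_one, one_smul, hitLaw, Measure.map_apply hS hA,
    Measure.restrict_apply (hS hA), inter_comm]

theorem ladderExitProb_le (hg : Measurable g) (B : Set (ℝ × E)) (s : ℝ) :
    ladderExitProb ν g B s ≤ hitMeasure ν g 1 (Ioi s) := by
  rw [hitMeasure_one_apply ν hg measurableSet_Ioi]
  exact ENNReal.tsum_le_tsum fun n => measure_mono fun x hx => ⟨hx.1, hx.2.1⟩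

theorem ladderExitProb_univ (hg : Measurable g) (s : ℝ) :
    ladderExitProb ν g univ s = hitMeasure ν g 1 (Ioi s) := by
  rw [hitMeasure_one_apply ν hg measurableSet_Ioi]
  exact tsum_congr fun n => congrArg _ (by ext x; simp [ladderExitSet])

theorem tendsto_ladderExitProb [IsFiniteMeasure (hitMeasure ν g 1)] (hg : Measurable g)
    (B : Set (ℝ × E)) : Tendsto (ladderExitProb ν g B) atTop (𝓝 0) := by
  have h : Tendsto (fun s : ℝ => hitMeasure ν g 1 (Ioi s)) atTop (𝓝 0) := by
    have := tendsto_measure_iInter_atTop (μ := hitMeasure ν g 1) (s := fun s : ℝ => Ioi s)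
      (fun s => measurableSet_Ioi.nullMeasurableSet) (fun a b hab => Ioi_subset_Ioi hab)
      ⟨0, measure_ne_top _ _⟩
    have h0 : ⋂ s : ℝ, Ioi s = ∅ := by
      refine eq_empty_of_forall_notMem fun x hx => ?_
      exact lt_irrefl x (mem_iInter.1 hx x)
    rwa [h0, measure_empty] at this
  exact tendsto_of_tendsto_of_tendsto_of_le_of_le tendsto_const_nhds h (fun _ => zero_le)
    (ladderExitProb_le ν hg B)

theorem measure_iUnion_hitSet [IsProbabilityMeasure (hitMeasure ν g 1)] (hg : Measurable g) :
    iidLaw ν (⋃ n, hitSet g n) = 1 := by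
  rw [measure_iUnion (disjoint_hitSet g) (measurableSet_hitSet hg)]
  have h := hitMeasure_one_apply ν hg MeasurableSet.univ
  rw [measure_univ] at h
  simpa using h.symm

/-- The renewal equation of the exit probabilities: decomposition at the first ladder height. -/
theorem exitProb_eq [IsProbabilityMeasure (hitMeasure ν g 1)] (hg : Measurable g)
    {B : Set (ℝ × E)} (hB : MeasurableSet B) {s : ℝ} (hs : 0 ≤ s) :
    iidLaw ν (exitSet g B s) = ladderExitProb ν g B s +
      ∫⁻ y, iidLaw ν (exitSet g B (s - y)) ∂(hitMeasure ν g 1) := by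
  have hS := measurable_pathSum hg
  have hjoint := measurableSet_exitSet hg hB
  have hex : MeasurableSet (exitSet g B s) := measurable_prodMk_left hjoint
  have hcompl : iidLaw ν (⋃ n, hitSet g n)ᶜ = 0 := by
    rw [prob_compl_eq_zero_iff (MeasurableSet.iUnion (measurableSet_hitSet hg))]
    exact measure_iUnion_hitSet ν hg
  have h1 : iidLaw ν (exitSet g B s) = ∑' n, iidLaw ν (hitSet g n ∩ exitSet g B s) := by
    rw [← measure_iUnion (fun m n hmn => ((disjoint_hitSet g hmn).mono inter_subset_left
      inter_subset_left)) (fun n => (measurableSet_hitSet hg n).inter hex), ← iUnion_inter]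
    refine measure_congr ?_
    have : ∀ᵐ x ∂iidLaw ν, x ∈ ⋃ n, hitSet g n := by
      rw [ae_iff]; exact hcompl
    filter_upwards [this] with x hx
    exact propext ⟨fun h => ⟨hx, h⟩, fun h => h.2⟩
  have h2 : ∀ n, iidLaw ν (hitSet g n ∩ exitSet g B s) = iidLaw ν (ladderExitSet g B n s) +
      ∫⁻ y, iidLaw ν (exitSet g B (s - y)) ∂(hitLaw ν g n) := by
    intro n
    rw [← measure_inter_add_sdiff (hitSet g n ∩ exitSet g B s)
      (measurableSet_lt (measurable_const (a := s)) (hS (n + 1)))]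
    congr 1
    · congr 1
      ext x
      constructor
      · rintro ⟨⟨ha, hb⟩, hc⟩
        exact ⟨ha, hc, (mem_exitSet_of_lt hs ha hc).1 hb⟩
      · rintro ⟨ha, hc, hb⟩
        exact ⟨⟨ha, (mem_exitSet_of_lt hs ha hc).2 hb⟩, hc⟩
    · have hshift : MeasurableSet {p : (ℕ → E) × (ℕ → E) |
          p.2 ∈ exitSet g B (s - pathSum g (n + 1) p.1)} :=
        ((measurable_const.sub ((hS (n + 1)).comp measurable_fst)).prodMk measurable_snd) hjoint
      have hset : (hitSet g n ∩ exitSet g B s) \ {x | s < pathSum g (n + 1) x} =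
          hitSet g n ∩ {x | shiftPath (n + 1) x ∈ exitSet g B (s - pathSum g (n + 1) x)} := by
        ext x
        constructor
        · rintro ⟨⟨ha, hb⟩, hc⟩
          exact ⟨ha, (mem_exitSet_of_le hs ha (not_lt.1 hc)).1 hb⟩
        · rintro ⟨ha, hb⟩
          -- `exitSet` is empty at negative levels, so the renewal integral needs no explicit
          -- restriction to ladder heights at most `s`.
          have hc : pathSum g (n + 1) x ≤ s := by
            by_contra hc
            have : shiftPath (n + 1) x ∈ exitSet g B (s - pathSum g (n + 1) x) := hb
            rw [exitSet_of_neg g B (by linarith)] at this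
            exact this
          exact ⟨⟨ha, (mem_exitSet_of_le hs ha hc).2 hb⟩, not_lt.2 hc⟩
      have hmset : MeasurableSet
          {x | shiftPath (n + 1) x ∈ exitSet g B (s - pathSum g (n + 1) x)} :=
        (measurable_id.prodMk (measurable_shiftPath (n + 1))) hshift
      rw [hset, ← lintegral_indicator_one ((measurableSet_hitSet hg n).inter hmset)]
      have hF := lintegral_shiftPath ν (n + 1)
        (F := fun x y => (hitSet g n).indicator 1 x *
          {p : (ℕ → E) × (ℕ → E) | p.2 ∈ exitSet g B (s - pathSum g (n + 1) p.1)}.indicator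
            1 (x, y)) ?_ ?_
      · rw [inter_indicator_one]
        refine hF.trans ?_
        rw [hitLaw, lintegral_map _ (hS (n + 1)), ← lintegral_indicator (measurableSet_hitSet hg n)]
        · refine lintegral_congr fun x => ?_
          by_cases hx : x ∈ hitSet g n
          · simp only [indicator_of_mem hx, Pi.one_apply, one_mul]
            have hms : MeasurableSet (exitSet g B (s - pathSum g (n + 1) x)) :=
              measurable_prodMk_left hjoint
            exact lintegral_indicator_one hms
          · simp [indicator_of_notMem hx]
        · exact (measurable_exitProb ν hg hB).comp (measurable_const.sub measurable_id)
      · exact ((measurable_one.indicator (measurableSet_hitSet hg n)).comp measurable_fst).mul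
          (measurable_one.indicator hshift)
      · intro x x' y h
        have e1 : x ∈ hitSet g n ↔ x' ∈ hitSet g n := by
          refine and_congr (forall₂_congr fun i hi => ?_) ?_
          · rw [pathSum_congr g fun j hj => h j (by omega)]
          · exact (by rw [pathSum_congr g h] :
              (0 < pathSum g (n + 1) x) ↔ (0 < pathSum g (n + 1) x'))
        have e2 : pathSum g (n + 1) x = pathSum g (n + 1) x' := pathSum_congr g h
        exact congrArg₂ _ (indicator_one_congr e1) (indicator_one_congr (by simp [e2]))
  rw [h1, lintegral_hitMeasure_one, ladderExitProb, ← ENNReal.tsum_add]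
  exact tsum_congr h2

/-- The total mass of the ladder exit probabilities. -/
theorem lintegral_ladderExitProb (hg : Measurable g) {B : Set (ℝ × E)} (hB : MeasurableSet B) :
    ∫⁻ s in Ici 0, ladderExitProb ν g B s = ∑' n, ∫⁻ x in hitSet g n,
      volume {s : ℝ | 0 ≤ s ∧ s < pathSum g (n + 1) x ∧ (s - pathSum g n x, x n) ∈ B}
        ∂(iidLaw ν) := by
  have hm := fun n => measurableSet_ladderExitSet hg hB n
  simp only [ladderExitProb]
  have hm' : ∀ n, Measurable fun s => iidLaw ν (ladderExitSet g B n s) := fun n =>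
    measurable_measure_prodMk_left (hm n)
  rw [lintegral_tsum fun n => (hm' n).aemeasurable]
  refine tsum_congr fun n => ?_
  calc ∫⁻ s in Ici 0, iidLaw ν (ladderExitSet g B n s)
      = ((volume.restrict (Ici 0)).prod (iidLaw ν))
          {p : ℝ × (ℕ → E) | p.2 ∈ ladderExitSet g B n p.1} := (Measure.prod_apply (hm n)).symm
    _ = ∫⁻ x, (volume.restrict (Ici (0 : ℝ))) {s | x ∈ ladderExitSet g B n s} ∂(iidLaw ν) :=
        Measure.prod_apply_symm (hm n)
    _ = _ := by
        rw [← lintegral_indicator (measurableSet_hitSet hg n)]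
        refine lintegral_congr fun x => ?_
        have hms : MeasurableSet {s | x ∈ ladderExitSet g B n s} := measurable_prodMk_right (hm n)
        rw [Measure.restrict_apply hms]
        by_cases hx : x ∈ hitSet g n
        · rw [indicator_of_mem hx]
          congr 1
          ext s
          exact ⟨fun h => ⟨h.2, h.1.2⟩, fun h => ⟨⟨hx, h.2⟩, h.1⟩⟩
        · rw [indicator_of_notMem hx]
          refine measure_mono_null (fun s hs => ?_) measure_empty
          exact absurd hs.1.1 hx

/-- A positive first step is itself the first ladder height, so the ladder law dominates the
positive part of the step law. -/
theorem restrict_Icc_le_hitMeasure (hg : Measurable g) {T : ℝ} {δ : ℝ≥0∞}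
    (h : δ • volume.restrict (Icc 0 T) ≤ ν.map g) :
    δ • volume.restrict (Icc 0 T) ≤ hitMeasure ν g 1 := by
  refine Measure.le_iff.2 fun A hA => ?_
  have h1 : ν.map g (A ∩ Ioi 0) ≤ hitMeasure ν g 1 A := by
    have := (stayLaw_conv ν hg 0)
    rw [stayLaw_zero, Measure.dirac_zero_conv] at this
    rw [this, Measure.add_apply, measure_mono_null inter_subset_right (stayLaw_Ioi ν hg 1),
      zero_add, hitMeasure, Measure.sum_apply _ hA]
    refine (measure_mono inter_subset_left).trans (le_trans (le_of_eq ?_) (ENNReal.le_tsum 0))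
    simp
  calc (δ • volume.restrict (Icc 0 T)) A = (δ • volume.restrict (Icc 0 T)) (A ∩ Ioi 0) := by
        rw [Measure.smul_apply, Measure.smul_apply, Measure.restrict_apply hA,
          Measure.restrict_apply (hA.inter measurableSet_Ioi)]
        congr 1
        refine measure_congr ?_
        have : ∀ᵐ y : ℝ, y ≠ 0 := by simp [ae_iff]
        filter_upwards [this] with y hy
        refine propext ⟨fun h => ⟨⟨h.1, lt_of_le_of_ne h.2.1 hy.symm⟩, h.2⟩,
          fun h => ⟨h.1.1, h.2⟩⟩
    _ ≤ ν.map g (A ∩ Ioi 0) := h _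
    _ ≤ hitMeasure ν g 1 A := h1

theorem tendsto_exitProb [IsProbabilityMeasure (hitMeasure ν g 1)] (hg : Measurable g)
    (hmean : ∫⁻ y, ENNReal.ofReal y ∂(hitMeasure ν g 1) ≠ ⊤)
    (hlow : ∀ T : ℝ, ∃ δ : ℝ≥0∞, δ ≠ 0 ∧ δ ≠ ⊤ ∧ δ • volume.restrict (Icc 0 T) ≤ ν.map g)
    {B : Set (ℝ × E)} (hB : MeasurableSet B) :
    Tendsto (fun s => iidLaw ν (exitSet g B s)) atTop
      (𝓝 ((∫⁻ s in Ici 0, ladderExitProb ν g B s) /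
        ∫⁻ y, ENNReal.ofReal y ∂(hitMeasure ν g 1))) := by
  refine tendsto_of_renewal (hitMeasure_Iic ν hg 1) hmean (fun T => ?_)
    (measurable_exitProb ν hg hB) (measurable_ladderExitProb ν hg hB) (fun s => prob_le_one)
    (fun s hs => by rw [exitSet_of_neg g B hs, measure_empty])
    (fun s hs => exitProb_eq ν hg hB hs) (tendsto_ladderExitProb ν hg B)
  obtain ⟨δ, h1, h2, h3⟩ := hlow T
  exact ⟨δ, h1, h2, restrict_Icc_le_hitMeasure ν hg h3⟩

/-- The walk exceeds every level. -/
theorem ae_mem_exitSet_univ [IsProbabilityMeasure (hitMeasure ν g 1)] (hg : Measurable g)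
    (hmean : ∫⁻ y, ENNReal.ofReal y ∂(hitMeasure ν g 1) ≠ ⊤)
    (hlow : ∀ T : ℝ, ∃ δ : ℝ≥0∞, δ ≠ 0 ∧ δ ≠ ⊤ ∧ δ • volume.restrict (Icc 0 T) ≤ ν.map g)
    {s : ℝ} (hs : 0 ≤ s) : ∀ᵐ x ∂(iidLaw ν), x ∈ exitSet g univ s := by
  have hpos := hitMeasure_Iic ν hg 1
  have hmean0 := lintegral_ofReal_ne_zero hpos
  -- With no condition on the crossing step the limit is mean over mean, that is one. Crossing a
  -- higher level implies crossing a lower one, so these probabilities decrease in the level and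
  -- must all equal one.
  have hlim := tendsto_exitProb ν hg hmean hlow MeasurableSet.univ
  simp only [ladderExitProb_univ ν hg] at hlim
  rw [lintegral_Ici_measure_Ioi hpos, ENNReal.div_self hmean0 hmean] at hlim
  have hanti : ∀ s' ≥ s, exitSet g univ s' ⊆ exitSet g univ s := by
    rintro s' hs' x ⟨n, -, h2, -⟩
    have hex : ∃ m, s < pathSum g (m + 1) x := ⟨n, hs'.trans_lt h2⟩
    classical
    refine ⟨Nat.find hex, fun i hi => ?_, Nat.find_spec hex, mem_univ _⟩
    rcases Nat.eq_zero_or_pos i with rfl | hi0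
    · rwa [pathSum_zero]
    · obtain ⟨j, rfl⟩ := Nat.exists_eq_succ_of_ne_zero hi0.ne'
      exact not_lt.1 (Nat.find_min hex (by omega))
  have h1 : 1 ≤ iidLaw ν (exitSet g univ s) :=
    le_of_tendsto hlim ((eventually_ge_atTop s).mono fun s' hs' => measure_mono (hanti s' hs'))
  have hmeas : MeasurableSet (exitSet g univ s) :=
    measurable_prodMk_left (measurableSet_exitSet hg MeasurableSet.univ)
  exact (mem_ae_iff_prob_eq_one hmeas).2 (le_antisymm prob_le_one h1)

end Passage
end CylinderLight

namespace CylinderLight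

/-! ### The axial step: symmetry, absence of atoms, domination of Lebesgue measure. -/

section StepLaw
open Set Real
open scoped ENNReal ComplexConjugate NNReal

/-- The uniform law on `[-π/2, π/2]`. -/
noncomputable def uniformLaw : Measure ℝ := ProbabilityTheory.cond volume (Icc (-(π / 2)) (π / 2))

/-- The joint law of the two angles of a reflection. -/
noncomputable def angleLaw : Measure (ℝ × ℝ) := lambertianLaw.prod uniformLaw

/-- The axial displacement along the chord with angles `e`. -/
noncomputable def axialStep (e : ℝ × ℝ) : ℝ := chordLength e.1 e.2 * (cos e.2 * sin e.1)

theorem measurable_axialStep : Measurable axialStep := by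
  unfold axialStep chordLength; fun_prop

theorem lintegral_lambertianLaw {f : ℝ → ℝ≥0∞} (hf : Measurable f) :
    ∫⁻ θ, f θ ∂lambertianLaw =
      ∫⁻ θ in Ioo (-(π / 2)) (π / 2), ENNReal.ofReal (cos θ / 2) * f θ := by
  rw [lambertianLaw, lintegral_withDensity_eq_lintegral_mul _ _ hf,
    ← lintegral_indicator measurableSet_Ioo]
  · refine lintegral_congr fun θ => ?_
    by_cases h : θ ∈ Ioo (-(π / 2)) (π / 2) <;> simp [h]
  · exact ENNReal.measurable_ofReal.comp
      ((measurable_cos.div_const 2).indicator measurableSet_Ioo)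

instance isProbabilityMeasure_lambertianLaw : IsProbabilityMeasure lambertianLaw := by
  refine ⟨?_⟩
  have hle : -(π / 2) ≤ π / 2 := by linarith [pi_pos]
  have h := lintegral_lambertianLaw (f := fun _ => 1) measurable_const
  rw [lintegral_one] at h
  rw [h]
  simp only [mul_one]
  rw [restrict_Ioo_eq_restrict_Ioc, ← ofReal_integral_eq_lintegral_ofReal,
    ← intervalIntegral.integral_of_le hle, intervalIntegral.integral_div, integral_cos]
  · simp
  · exact ((continuous_cos.div_const 2).intervalIntegrable _ _).1
  · refine (ae_restrict_iff' measurableSet_Ioc).2 (Eventually.of_forall fun θ hθ => ?_)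
    have := cos_nonneg_of_mem_Icc ⟨hθ.1.le, hθ.2⟩
    simp only [Pi.zero_apply]
    positivity

theorem uniformLaw_eq : uniformLaw =
    ENNReal.ofReal π⁻¹ • volume.restrict (Ioc (-(π / 2)) (π / 2)) := by
  rw [uniformLaw, ProbabilityTheory.cond, Real.volume_Icc, sub_neg_eq_add, add_halves,
    ENNReal.ofReal_inv_of_pos pi_pos, restrict_Ioc_eq_restrict_Icc]

instance isProbabilityMeasure_uniformLaw : IsProbabilityMeasure uniformLaw := by
  refine ⟨?_⟩
  rw [uniformLaw_eq]
  simp [ENNReal.ofReal_inv_of_pos pi_pos]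
  rw [ENNReal.inv_mul_cancel] <;> simp [pi_pos]

instance isProbabilityMeasure_angleLaw : IsProbabilityMeasure angleLaw := by
  unfold angleLaw; infer_instance

theorem lintegral_angleLaw {f : ℝ × ℝ → ℝ≥0∞} (hf : Measurable f) :
    ∫⁻ e, f e ∂angleLaw = ∫⁻ θ in Ioo (-(π / 2)) (π / 2), ENNReal.ofReal (cos θ / 2) *
      (ENNReal.ofReal π⁻¹ * ∫⁻ φ in Ioc (-(π / 2)) (π / 2), f (θ, φ)) := by
  rw [angleLaw, lintegral_prod _ hf.aemeasurable, lintegral_lambertianLaw hf.lintegral_prod_right']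
  simp only [uniformLaw_eq, lintegral_smul_measure, smul_eq_mul]

theorem axialStep_neg (θ φ : ℝ) : axialStep (-θ, φ) = -axialStep (θ, φ) := by
  simp [axialStep, chordLength]

theorem map_neg_lambertianLaw : lambertianLaw.map (fun θ => -θ) = lambertianLaw := by
  ext A hA
  have hf : Measurable (A.indicator (1 : ℝ → ℝ≥0∞)) := measurable_one.indicator hA
  rw [← lintegral_indicator_one hA, ← lintegral_indicator_one hA, lintegral_map hf measurable_neg,
    lintegral_lambertianLaw hf,
    lintegral_lambertianLaw (f := fun θ => A.indicator 1 (-θ)) (hf.comp measurable_neg),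
    ← lintegral_indicator measurableSet_Ioo, ← lintegral_indicator measurableSet_Ioo,
    ← lintegral_neg_eq_self]
  refine lintegral_congr fun θ => ?_
  have : -θ ∈ Ioo (-(π / 2)) (π / 2) ↔ θ ∈ Ioo (-(π / 2)) (π / 2) := by
    simp only [mem_Ioo]; constructor <;> rintro ⟨a, b⟩ <;> constructor <;> linarith
  by_cases h : θ ∈ Ioo (-(π / 2)) (π / 2)
  · rw [indicator_of_mem (this.2 h), indicator_of_mem h]; simp
  · rw [indicator_of_notMem (mt this.1 h), indicator_of_notMem h]

/-- The step is odd in $\theta$ and the law of $\theta$ is even, so the step law is symmetric and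
its characteristic function real. -/
theorem conj_charFun_axialStep (t : ℝ) :
    conj (charFun (angleLaw.map axialStep) t) = charFun (angleLaw.map axialStep) t := by
  rw [← charFun_map_neg, Measure.map_map measurable_neg measurable_axialStep]
  congr 1
  have h : angleLaw.map (Prod.map (fun θ => -θ) id) = angleLaw := by
    rw [angleLaw, ← Measure.map_prod_map _ _ measurable_neg measurable_id, map_neg_lambertianLaw,
      Measure.map_id]
  conv_rhs => rw [← h]
  rw [Measure.map_map measurable_axialStep (measurable_neg.prodMap measurable_id)]
  congr 1
  ext ⟨θ, φ⟩
  simp [axialStep_neg]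

theorem axialStep_eq_tan {θ : ℝ} (hθ : cos θ ≠ 0) (φ : ℝ) :
    axialStep (θ, φ) = 2 * cos φ * tan θ / (1 + sin φ ^ 2 * tan θ ^ 2) := by
  have h1 : sin φ ^ 2 * sin θ ^ 2 + cos θ ^ 2 ≠ 0 := by positivity
  have h2 : 1 + sin φ ^ 2 * tan θ ^ 2 = (sin φ ^ 2 * sin θ ^ 2 + cos θ ^ 2) / cos θ ^ 2 := by
    rw [tan_eq_sin_div_cos]; field_simp; ring
  rw [h2, tan_eq_sin_div_cos]
  simp only [axialStep, chordLength]
  field_simp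

theorem lambertianLaw_ac : lambertianLaw ≪ volume := withDensity_absolutelyContinuous _ _

theorem lambertianLaw_compl : ∀ᵐ θ ∂lambertianLaw, θ ∈ Ioo (-(π / 2)) (π / 2) := by
  rw [ae_iff, ← Set.compl_def, ← lintegral_indicator_one measurableSet_Ioo.compl,
    lintegral_lambertianLaw (measurable_one.indicator measurableSet_Ioo.compl)]
  refine (setLIntegral_congr_fun measurableSet_Ioo fun θ hθ => ?_).trans lintegral_zero
  rw [indicator_of_notMem (by simpa using hθ), mul_zero]

/-- For fixed $\varphi$ with $\cos\varphi\ne0$, the equation $X=a$ is polynomial in $\tan\theta$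
with nonzero linear coefficient $-2\cos\varphi$. It has finitely many roots, and $\tan$ is injective
on the open interval. -/
theorem map_axialStep_singleton (a : ℝ) : angleLaw.map axialStep {a} = 0 := by
  rw [Measure.map_apply measurable_axialStep (measurableSet_singleton a), angleLaw,
    Measure.prod_apply_symm (measurable_axialStep (measurableSet_singleton a))]
  have hφ : ∀ᵐ φ ∂uniformLaw, cos φ ≠ 0 := by
    rw [uniformLaw_eq]
    refine Measure.ae_smul_measure ?_ _
    have h : ∀ᵐ φ : ℝ, φ ≠ π / 2 := by simp [ae_iff]
    refine (ae_restrict_iff' measurableSet_Ioc).2 ?_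
    filter_upwards [h] with φ h1 h2
    exact (cos_pos_of_mem_Ioo ⟨h2.1, lt_of_le_of_ne h2.2 h1⟩).ne'
  refine (lintegral_congr_ae ?_).trans lintegral_zero
  filter_upwards [hφ] with φ hφ
  have hfin : (Ioo (-(π / 2)) (π / 2) ∩ {θ | axialStep (θ, φ) = a}).Finite := by
    have hroots : {τ : ℝ | a * sin φ ^ 2 * (τ * τ) + (-(2 * cos φ)) * τ + a = 0}.Finite := by
      generalize a * sin φ ^ 2 = α
      set p : Polynomial ℝ := Polynomial.C α * Polynomial.X ^ 2 +
        Polynomial.C (-(2 * cos φ)) * Polynomial.X + Polynomial.C a with hp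
      have hp0 : p ≠ 0 := by
        intro h
        have h1 := congrArg (fun q => Polynomial.coeff q 1) h
        simp [hp, Polynomial.coeff_C] at h1
        exact hφ h1
      refine (p.roots.toFinset.finite_toSet).subset fun τ hτ => ?_
      simp only [SetLike.mem_coe, Multiset.mem_toFinset, Polynomial.mem_roots hp0,
        Polynomial.IsRoot.def]
      have hτ' : α * (τ * τ) + (-(2 * cos φ)) * τ + a = 0 := hτ
      rw [hp]
      simp only [Polynomial.eval_add, Polynomial.eval_mul, Polynomial.eval_C, Polynomial.eval_pow,
        Polynomial.eval_X]
      linarith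
    refine Finite.of_finite_image (f := tan) (hroots.subset ?_) (injOn_tan.mono inter_subset_left)
    rintro _ ⟨θ, ⟨hθ, h⟩, rfl⟩
    have h' : axialStep (θ, φ) = a := h
    rw [axialStep_eq_tan (cos_pos_of_mem_Ioo hθ).ne', div_eq_iff (by positivity)] at h'
    show a * sin φ ^ 2 * (tan θ * tan θ) + (-(2 * cos φ)) * tan θ + a = 0
    linarith
  have h0 : lambertianLaw (Ioo (-(π / 2)) (π / 2) ∩ {θ | axialStep (θ, φ) = a}) = 0 :=
    lambertianLaw_ac (hfin.measure_zero _)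
  refine le_antisymm (le_trans ?_ h0.le) zero_le
  refine measure_mono_ae ?_
  filter_upwards [lambertianLaw_compl] with θ hθ h
  exact ⟨hθ, h⟩

/-- The step law dominates a multiple of Lebesgue measure on every bounded interval. -/
theorem exists_smul_restrict_le_map_axialStep (T : ℝ) :
    ∃ δ : ℝ≥0∞, δ ≠ 0 ∧ δ ≠ ⊤ ∧ δ • volume.restrict (Icc 0 T) ≤ angleLaw.map axialStep := by
  -- For fixed $\varphi$ in $(0,\pi/2)$ the step at $\tan\theta=1/\sin\varphi$ equals $\cot\varphi$.
  -- The choice $\tan\varphi_1=1/T'$ makes this at least $T$ whenever $\varphi\le\varphi_1$, and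
  -- $\theta_1$ is large enough to reach that $\theta$ for every $\varphi\ge\varphi_1/2$.
  set T' := max T 0 + 1
  have hTT : T ≤ T' := (le_max_left T 0).trans (by linarith)
  set φ₁ := arctan (1 / T')
  have hφpos : 0 < φ₁ := arctan_pos.2 (by positivity)
  have hφlt : φ₁ < π / 2 := arctan_lt_pi_div_two _
  set θ₁ := arctan (1 / sin (φ₁ / 2))
  have hsin : 0 < sin (φ₁ / 2) := sin_pos_of_pos_of_lt_pi (by linarith) (by linarith)
  have hθlt : θ₁ < π / 2 := arctan_lt_pi_div_two _
  have hcos1 : 0 < cos θ₁ := cos_arctan_pos _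
  have hcosθ : ∀ θ ∈ Icc 0 θ₁, cos θ₁ ≤ cos θ := fun θ hθ =>
    cos_le_cos_of_nonneg_of_le_pi hθ.1 (by linarith) hθ.2
  set K : ℝ≥0 := Real.toNNReal (2 / cos θ₁ ^ 2) with hK
  have hK0 : K ≠ 0 := by
    rw [hK, ne_eq, Real.toNNReal_eq_zero, not_le]
    positivity
  have hlip : ∀ φ, LipschitzOnWith K (fun θ => axialStep (θ, φ)) (Icc 0 θ₁) := by
    intro φ
    refine LipschitzOnWith.of_dist_le_mul fun x hx y hy => ?_
    have hcx := hcos1.trans_le (hcosθ x hx)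
    have hcy := hcos1.trans_le (hcosθ y hy)
    simp only [dist_eq_norm, Real.norm_eq_abs]
    rw [axialStep_eq_tan hcx.ne', axialStep_eq_tan hcy.ne']
    have htan : |tan x - tan y| ≤ |x - y| / cos θ₁ ^ 2 := by
      have : tan x - tan y = sin (x - y) / (cos x * cos y) := by
        rw [tan_eq_sin_div_cos, tan_eq_sin_div_cos, sin_sub]; field_simp
      rw [this, abs_div, abs_of_pos (mul_pos hcx hcy), sq]
      exact div_le_div₀ (abs_nonneg _) abs_sin_le_abs (by positivity)
        (mul_le_mul (hcosθ x hx) (hcosθ y hy) hcos1.le hcx.le)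
    -- As a function of $\tau=\tan\theta$ the step is $2$-Lipschitz uniformly in $\varphi$; with the
    -- bound $1/\cos^2\theta_1$ for $\tan$ this explains $K$.
    have hh : ∀ τ σ : ℝ, |2 * cos φ * τ / (1 + sin φ ^ 2 * τ ^ 2) -
        2 * cos φ * σ / (1 + sin φ ^ 2 * σ ^ 2)| ≤ 2 * |τ - σ| := by
      intro τ σ
      have e : 2 * cos φ * τ / (1 + sin φ ^ 2 * τ ^ 2) -
          2 * cos φ * σ / (1 + sin φ ^ 2 * σ ^ 2) = 2 * (τ - σ) * (cos φ *
          ((1 - sin φ ^ 2 * (τ * σ)) / ((1 + sin φ ^ 2 * τ ^ 2) * (1 + sin φ ^ 2 * σ ^ 2)))) := by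
        field_simp
        ring
      have hq : |(1 - sin φ ^ 2 * (τ * σ)) / ((1 + sin φ ^ 2 * τ ^ 2) *
          (1 + sin φ ^ 2 * σ ^ 2))| ≤ 1 := by
        rw [abs_div, abs_of_pos (by positivity : 0 < (1 + sin φ ^ 2 * τ ^ 2) *
          (1 + sin φ ^ 2 * σ ^ 2)), div_le_one (by positivity), abs_le]
        constructor <;>
          nlinarith [sq_nonneg (sin φ * (τ - σ)), sq_nonneg (sin φ * (τ + σ)),
            sq_nonneg (sin φ ^ 2 * (τ * σ)), sq_nonneg (sin φ * τ), sq_nonneg (sin φ * σ)]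
      rw [e, abs_mul, abs_mul, abs_mul, abs_two]
      have := mul_le_one₀ (abs_cos_le_one φ) (abs_nonneg _) hq
      exact mul_le_of_le_one_right (by positivity) this
    calc _ ≤ 2 * |tan x - tan y| := hh _ _
      _ ≤ 2 * (|x - y| / cos θ₁ ^ 2) := by gcongr
      _ = (K : ℝ) * |x - y| := by
          rw [hK, Real.coe_toNNReal _ (by positivity)]; ring
  have hsurj : ∀ φ ∈ Icc (φ₁ / 2) φ₁, Icc 0 T ⊆ (fun θ => axialStep (θ, φ)) '' Icc 0 θ₁ := by
    intro φ hφ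
    have hs : 0 < sin φ := sin_pos_of_pos_of_lt_pi (by linarith [hφ.1]) (by linarith [hφ.2])
    have hc : 0 < cos φ := cos_pos_of_mem_Ioo ⟨by linarith [hφ.1], by linarith [hφ.2]⟩
    have hle : arctan (1 / sin φ) ≤ θ₁ := by
      refine arctan_strictMono.monotone (one_div_le_one_div_of_le hsin ?_)
      exact sin_le_sin_of_le_of_le_pi_div_two (by linarith) (by linarith [hφ.2]) hφ.1
    have h0 : 0 ≤ arctan (1 / sin φ) := (arctan_pos.2 (by positivity)).le
    have hivt := intermediate_value_Icc h0
      ((hlip φ).continuousOn.mono (Icc_subset_Icc_right hle))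
    have hv0 : axialStep (0, φ) = 0 := by simp [axialStep]
    have hv1 : T ≤ axialStep (arctan (1 / sin φ), φ) := by
      rw [axialStep_eq_tan (cos_arctan_pos _).ne', tan_arctan]
      have e : 2 * cos φ * (1 / sin φ) / (1 + sin φ ^ 2 * (1 / sin φ) ^ 2) = 1 / tan φ := by
        rw [tan_eq_sin_div_cos]; field_simp; norm_num
      rw [e]
      have htan : tan φ ≤ 1 / T' := by
        rw [← tan_arctan (1 / T')]
        exact strictMonoOn_tan.monotoneOn ⟨by linarith [hφ.1], by linarith [hφ.2]⟩
          ⟨by linarith, hφlt⟩ hφ.2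
      have htp : 0 < tan φ := by rw [tan_eq_sin_div_cos]; positivity
      rw [le_one_div htp (by positivity)] at htan
      exact hTT.trans htan
    refine (Icc_subset_Icc hv0.le hv1).trans (hivt.trans (image_mono (Icc_subset_Icc_right hle)))
  have hslice : ∀ φ ∈ Icc (φ₁ / 2) φ₁, ∀ A : Set ℝ, MeasurableSet A →
      ENNReal.ofReal (cos θ₁ / 2) * (K : ℝ≥0∞)⁻¹ * volume (A ∩ Icc 0 T) ≤
        lambertianLaw ((fun θ => axialStep (θ, φ)) ⁻¹' A) := by
    intro φ hφ A hA
    set W := (fun θ => axialStep (θ, φ)) ⁻¹' A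
    have hWm : MeasurableSet W :=
      (measurable_axialStep.comp (measurable_id.prodMk measurable_const)) hA
    have hsub : A ∩ Icc 0 T ⊆ (fun θ => axialStep (θ, φ)) '' (W ∩ Icc 0 θ₁) := by
      rintro a ⟨ha, haT⟩
      obtain ⟨θ, hθ, rfl⟩ := hsurj φ hφ haT
      exact ⟨θ, ⟨ha, hθ⟩, rfl⟩
    -- A $K$-Lipschitz map enlarges one-dimensional Hausdorff measure, here Lebesgue measure, by at
    -- most $K$; the image covers the target by `hsurj`.
    have h1 : volume (A ∩ Icc 0 T) ≤ K * volume (W ∩ Icc 0 θ₁) := by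
      have := ((hlip φ).mono (inter_subset_right (s := W))).hausdorffMeasure_image_le
        (d := 1) zero_le_one
      rw [hausdorffMeasure_real, ENNReal.rpow_one] at this
      exact (measure_mono hsub).trans this
    calc ENNReal.ofReal (cos θ₁ / 2) * (K : ℝ≥0∞)⁻¹ * volume (A ∩ Icc 0 T)
        ≤ ENNReal.ofReal (cos θ₁ / 2) * (K : ℝ≥0∞)⁻¹ * (K * volume (W ∩ Icc 0 θ₁)) := by gcongr
      _ = ENNReal.ofReal (cos θ₁ / 2) * volume (W ∩ Icc 0 θ₁) := by
          rw [mul_assoc, ← mul_assoc _ (K : ℝ≥0∞), ENNReal.inv_mul_cancel (by exact_mod_cast hK0)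
            ENNReal.coe_ne_top, one_mul]
      _ = ∫⁻ θ in W ∩ Icc 0 θ₁, ENNReal.ofReal (cos θ₁ / 2) := (setLIntegral_const _ _).symm
      _ ≤ ∫⁻ θ in W ∩ Icc 0 θ₁, ENNReal.ofReal (cos θ / 2) := by
          refine setLIntegral_mono (by fun_prop) fun θ hθ => ENNReal.ofReal_le_ofReal ?_
          linarith [hcosθ θ hθ.2]
      _ ≤ ∫⁻ θ in W ∩ Ioo (-(π / 2)) (π / 2), ENNReal.ofReal (cos θ / 2) :=
          lintegral_mono_set (inter_subset_inter_right _ fun θ hθ =>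
            ⟨by linarith [hθ.1, pi_pos], by linarith [hθ.2]⟩)
      _ = lambertianLaw W := by
          rw [← lintegral_indicator_one hWm,
            lintegral_lambertianLaw (measurable_one.indicator hWm),
            ← setLIntegral_indicator hWm]
          refine lintegral_congr fun θ => ?_
          by_cases h : θ ∈ W <;> simp [h]
  have hmass : uniformLaw (Icc (φ₁ / 2) φ₁) ≠ 0 := by
    rw [uniformLaw_eq, Measure.smul_apply, Measure.restrict_apply measurableSet_Icc,
      inter_eq_left.2 (show Icc (φ₁ / 2) φ₁ ⊆ Ioc (-(π / 2)) (π / 2) from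
        fun φ hφ => ⟨by linarith [hφ.1, pi_pos], by linarith [hφ.2]⟩),
      Real.volume_Icc, smul_eq_mul]
    refine mul_ne_zero ?_ ?_
    · simpa using pi_pos
    · simp only [ne_eq, ENNReal.ofReal_eq_zero, not_le]; linarith
  refine ⟨ENNReal.ofReal (cos θ₁ / 2) * (K : ℝ≥0∞)⁻¹ * uniformLaw (Icc (φ₁ / 2) φ₁), ?_, ?_, ?_⟩
  · refine mul_ne_zero (mul_ne_zero ?_ ?_) hmass
    · simp only [ne_eq, ENNReal.ofReal_eq_zero, not_le]; positivity
    · simp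
  · refine ENNReal.mul_ne_top (ENNReal.mul_ne_top ENNReal.ofReal_ne_top ?_) (measure_ne_top _ _)
    simpa using hK0
  · refine Measure.le_iff.2 fun A hA => ?_
    rw [Measure.map_apply measurable_axialStep hA, angleLaw,
      Measure.prod_apply_symm (measurable_axialStep hA), Measure.smul_apply,
      Measure.restrict_apply hA, smul_eq_mul]
    calc _ = ∫⁻ φ in Icc (φ₁ / 2) φ₁,
          ENNReal.ofReal (cos θ₁ / 2) * (K : ℝ≥0∞)⁻¹ * volume (A ∩ Icc 0 T) ∂uniformLaw := by
          rw [setLIntegral_const]; ring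
      _ ≤ ∫⁻ φ in Icc (φ₁ / 2) φ₁, lambertianLaw ((fun θ => axialStep (θ, φ)) ⁻¹' A)
            ∂uniformLaw :=
          setLIntegral_mono' measurableSet_Icc fun φ hφ => hslice φ hφ A hA
      _ ≤ _ := setLIntegral_le_lintegral _ _

end StepLaw
end CylinderLight

namespace CylinderLight

/-! ### The positive part and the second moment of the axial step. -/

section StepMoments
open Set Real
open scoped ENNReal

theorem neg_pi_div_two_le : -(π / 2) ≤ π / 2 := by linarith [pi_pos]

theorem integral_axialStep {θ : ℝ} (hθ : θ ∈ Ioo (-(π / 2)) (π / 2)) :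
    IntervalIntegrable (fun φ => axialStep (θ, φ)) volume (-(π / 2)) (π / 2) ∧
      ∫ φ in (-(π / 2))..(π / 2), axialStep (θ, φ) = 4 * θ := by
  have hc := (cos_pos_of_mem_Ioo hθ).ne'
  have hcont : Continuous fun φ => axialStep (θ, φ) := by
    have : (fun φ => axialStep (θ, φ)) = fun φ =>
        2 * cos φ * tan θ / (1 + sin φ ^ 2 * tan θ ^ 2) := funext fun φ => axialStep_eq_tan hc φ
    rw [this]
    exact Continuous.div (by fun_prop) (by fun_prop) fun φ => by positivity
  have hder : ∀ φ ∈ uIcc (-(π / 2)) (π / 2),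
      HasDerivAt (fun φ => 2 * arctan (tan θ * sin φ)) (axialStep (θ, φ)) φ := by
    intro φ _
    refine ((((hasDerivAt_sin φ).const_mul (tan θ)).arctan).const_mul 2).congr_deriv ?_
    rw [axialStep_eq_tan hc, mul_pow]
    ring
  refine ⟨hcont.intervalIntegrable _ _, ?_⟩
  rw [intervalIntegral.integral_eq_sub_of_hasDerivAt hder (hcont.intervalIntegrable _ _)]
  simp only [sin_pi_div_two, sin_neg, mul_neg, mul_one, arctan_neg, arctan_tan hθ.1 hθ.2]
  ring

/-- Only $\theta>0$ is kept. There the $\varphi$-integral of the step is $4\theta$, so the bound is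
$\frac2\pi\int_0^{\pi/2}\theta\cos\theta\,d\theta=1-\frac2\pi$. -/
theorem ofReal_le_lintegral_axialStep :
    ENNReal.ofReal (1 - 2 / π) ≤ ∫⁻ e, ENNReal.ofReal (axialStep e) ∂angleLaw := by
  rw [lintegral_angleLaw measurable_axialStep.ennreal_ofReal]
  have hsub : Ioc 0 (π / 2) ≤ᵐ[volume] Ioo (-(π / 2)) (π / 2) := by
    refine Ioo_ae_eq_Ioc.symm.le.trans ?_
    exact LE.le.eventuallyLE (Ioo_subset_Ioo_left (by linarith [pi_pos]))
  have hinner : ∀ θ ∈ Ioo (-(π / 2)) (π / 2), 0 ≤ θ →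
      ∫⁻ φ in Ioc (-(π / 2)) (π / 2), ENNReal.ofReal (axialStep (θ, φ)) =
        ENNReal.ofReal (4 * θ) := by
    intro θ hθ h0
    obtain ⟨h1, h2⟩ := integral_axialStep hθ
    rw [intervalIntegral.integral_of_le neg_pi_div_two_le] at h2
    rw [← h2, ofReal_integral_eq_lintegral_ofReal h1.1]
    refine (ae_restrict_iff' measurableSet_Ioc).2 (Eventually.of_forall fun φ hφ => ?_)
    have hc := cos_pos_of_mem_Ioo hθ
    have hc' := cos_nonneg_of_mem_Icc ⟨hφ.1.le, hφ.2⟩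
    have ht : 0 ≤ tan θ := tan_nonneg_of_nonneg_of_le_pi_div_two h0 hθ.2.le
    simp only [Pi.zero_apply]
    rw [axialStep_eq_tan hc.ne']
    positivity
  have houter : ∫ θ in (0)..(π / 2), 2 / π * (θ * cos θ) = 1 - 2 / π := by
    have hder : ∀ θ ∈ uIcc 0 (π / 2),
        HasDerivAt (fun θ => 2 / π * (θ * sin θ + cos θ)) (2 / π * (θ * cos θ)) θ := by
      intro θ _
      refine ((((hasDerivAt_id θ).mul (hasDerivAt_sin θ)).add (hasDerivAt_cos θ)).const_mul
        (2 / π)).congr_deriv ?_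
      simp only [id]; ring
    rw [intervalIntegral.integral_eq_sub_of_hasDerivAt hder
      ((by fun_prop : Continuous fun θ => 2 / π * (θ * cos θ)).intervalIntegrable _ _)]
    simp only [sin_pi_div_two, cos_pi_div_two, sin_zero, cos_zero]
    have := pi_ne_zero
    field_simp
    ring
  calc ENNReal.ofReal (1 - 2 / π)
      = ∫⁻ θ in Ioc 0 (π / 2), ENNReal.ofReal (2 / π * (θ * cos θ)) := by
        rw [← houter, intervalIntegral.integral_of_le (by positivity),
          ofReal_integral_eq_lintegral_ofReal]
        · exact ((by fun_prop : Continuous fun θ => 2 / π * (θ * cos θ)).intervalIntegrable _ _).1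
        · refine (ae_restrict_iff' measurableSet_Ioc).2 (Eventually.of_forall fun θ hθ => ?_)
          have hc := cos_nonneg_of_mem_Icc ⟨by linarith [hθ.1, pi_pos], hθ.2⟩
          have := hθ.1.le
          simp only [Pi.zero_apply]
          positivity
    _ = ∫⁻ θ in Ioc 0 (π / 2), ENNReal.ofReal (cos θ / 2) * (ENNReal.ofReal π⁻¹ *
          ∫⁻ φ in Ioc (-(π / 2)) (π / 2), ENNReal.ofReal (axialStep (θ, φ))) := by
        rw [← restrict_Ioo_eq_restrict_Ioc]
        refine setLIntegral_congr_fun measurableSet_Ioo fun θ hθ => ?_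
        have hmem : θ ∈ Ioo (-(π / 2)) (π / 2) := ⟨by linarith [hθ.1, pi_pos], hθ.2⟩
        have hc := cos_pos_of_mem_Ioo hmem
        rw [hinner θ hmem hθ.1.le, ← ENNReal.ofReal_mul (by positivity),
          ← ENNReal.ofReal_mul (by positivity)]
        congr 1
        field_simp
        ring
    _ ≤ _ := lintegral_mono' (Measure.restrict_mono_ae hsub) le_rfl

/-- The algebra behind the antiderivative in `integral_axialStep_sq`, with $p=\sin\varphi$,
$q=\cos\varphi$, $S=\sin\theta$, $a=\cos\theta$. -/
theorem quotient_identity {p q S a D : ℝ} (hD : D ≠ 0) (hq : q ≠ 0) (ha : a ≠ 0)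
    (hpq : p ^ 2 + q ^ 2 = 1) (h : D = p ^ 2 * S ^ 2 + a ^ 2) :
    2 * S ^ 2 * (((q * q + p * -p) * D - p * q * (2 * p * q * S ^ 2)) / D ^ 2) +
      2 * S ^ 2 / a * (1 / (D / (q ^ 2 * a ^ 2)) * (1 / q ^ 2 / a)) =
    (2 * a / D * (q * S)) ^ 2 := by
  have e1 : 2 * S ^ 2 / a * (1 / (D / (q ^ 2 * a ^ 2)) * (1 / q ^ 2 / a)) =
      2 * S ^ 2 * D / D ^ 2 := by field_simp
  have e2 : (q * q + p * -p) * D - p * q * (2 * p * q * S ^ 2) = 2 * q ^ 2 * a ^ 2 - D := by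
    linear_combination -D * hpq + 2 * q ^ 2 * h
  rw [e1, e2]
  field_simp
  ring

theorem integral_axialStep_sq {θ : ℝ} (hθ : θ ∈ Ioo (-(π / 2)) (π / 2)) :
    IntervalIntegrable (fun φ => axialStep (θ, φ) ^ 2) volume (-(π / 2)) (π / 2) ∧
      ∫ φ in (-(π / 2))..(π / 2), axialStep (θ, φ) ^ 2 = 2 * π * sin θ ^ 2 / cos θ := by
  have hc := cos_pos_of_mem_Ioo hθ
  have hD : ∀ φ, 0 < sin φ ^ 2 * sin θ ^ 2 + cos θ ^ 2 := fun φ => by positivity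
  have hcont : Continuous fun φ => axialStep (θ, φ) ^ 2 := by
    unfold axialStep chordLength
    refine ((Continuous.div (by fun_prop) (by fun_prop) fun φ => (hD φ).ne').mul
      (by fun_prop)).pow 2
  -- An antiderivative on the open interval only, because of $\tan\varphi$. At the endpoints the
  -- rational part tends to zero and the arctangent to $\pm\pi/2$, so the arctangent term alone
  -- yields the value.
  set F : ℝ → ℝ := fun φ => 2 * sin θ ^ 2 * (sin φ * cos φ /
      (sin φ ^ 2 * sin θ ^ 2 + cos θ ^ 2)) + 2 * sin θ ^ 2 / cos θ * arctan (tan φ / cos θ)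
  have hder : ∀ φ ∈ Ioo (-(π / 2)) (π / 2), HasDerivAt F (axialStep (θ, φ) ^ 2) φ := by
    intro φ hφ
    have hcφ := (cos_pos_of_mem_Ioo hφ).ne'
    have h1 := (((hasDerivAt_sin φ).mul (hasDerivAt_cos φ)).div
      ((((hasDerivAt_sin φ).pow 2).mul_const (sin θ ^ 2)).add_const (cos θ ^ 2))
      (hD φ).ne').const_mul (2 * sin θ ^ 2)
    have h2 := (((hasDerivAt_tan hcφ).div_const (cos θ)).arctan).const_mul (2 * sin θ ^ 2 / cos θ)
    refine (h1.add h2).congr_deriv ?_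
    have e1 : 1 + (tan φ / cos θ) ^ 2 =
        (sin φ ^ 2 * sin θ ^ 2 + cos θ ^ 2) / (cos φ ^ 2 * cos θ ^ 2) := by
      rw [tan_eq_sin_div_cos]
      field_simp
      rw [sin_sq θ, cos_sq' φ]
      ring
    rw [e1]
    simp only [axialStep, chordLength, Pi.mul_apply, Pi.pow_apply, Nat.cast_ofNat, pow_one,
      Nat.add_one_sub_one]
    exact quotient_identity (hD φ).ne' hcφ hc.ne' (sin_sq_add_cos_sq φ) rfl
  have hcos0 : Tendsto (fun φ => 2 * sin θ ^ 2 * (sin φ * cos φ /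
      (sin φ ^ 2 * sin θ ^ 2 + cos θ ^ 2))) (𝓝 (π / 2)) (𝓝 0) := by
    have : Continuous fun φ => 2 * sin θ ^ 2 * (sin φ * cos φ /
        (sin φ ^ 2 * sin θ ^ 2 + cos θ ^ 2)) :=
      continuous_const.mul (Continuous.div (by fun_prop) (by fun_prop) fun φ => (hD φ).ne')
    simpa using this.tendsto (π / 2)
  have hcos0' : Tendsto (fun φ => 2 * sin θ ^ 2 * (sin φ * cos φ /
      (sin φ ^ 2 * sin θ ^ 2 + cos θ ^ 2))) (𝓝 (-(π / 2))) (𝓝 0) := by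
    have : Continuous fun φ => 2 * sin θ ^ 2 * (sin φ * cos φ /
        (sin φ ^ 2 * sin θ ^ 2 + cos θ ^ 2)) :=
      continuous_const.mul (Continuous.div (by fun_prop) (by fun_prop) fun φ => (hD φ).ne')
    simpa using this.tendsto (-(π / 2))
  have hlimR : Tendsto F (𝓝[<] (π / 2)) (𝓝 (0 + 2 * sin θ ^ 2 / cos θ * (π / 2))) := by
    refine (hcos0.mono_left nhdsWithin_le_nhds).add (Tendsto.const_mul _ ?_)
    exact (tendsto_arctan_atTop.mono_right nhdsWithin_le_nhds).comp
      (tendsto_tan_pi_div_two.atTop_div_const hc)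
  have hlimL : Tendsto F (𝓝[>] (-(π / 2))) (𝓝 (0 + 2 * sin θ ^ 2 / cos θ * (-(π / 2)))) := by
    refine (hcos0'.mono_left nhdsWithin_le_nhds).add (Tendsto.const_mul _ ?_)
    exact (tendsto_arctan_atBot.mono_right nhdsWithin_le_nhds).comp
      (tendsto_tan_neg_pi_div_two.atBot_div_const hc)
  refine ⟨hcont.intervalIntegrable _ _, ?_⟩
  rw [intervalIntegral.integral_eq_sub_of_hasDerivAt_of_tendsto (neg_lt_self pi_div_two_pos) hder
    (hcont.intervalIntegrable _ _) hlimL hlimR]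
  ring

/-- The factor $1/\cos\theta$ of the inner integral cancels against the Lambertian density, leaving
$\int\sin^2\theta\,d\theta$ over $(-\pi/2,\pi/2)$. -/
theorem lintegral_axialStep_sq :
    ∫⁻ e, ENNReal.ofReal (axialStep e ^ 2) ∂angleLaw = ENNReal.ofReal (π / 2) := by
  rw [lintegral_angleLaw (measurable_axialStep.pow_const 2).ennreal_ofReal]
  have houter : ∫ θ in (-(π / 2))..(π / 2), sin θ ^ 2 = π / 2 := by
    rw [integral_sin_sq]; simp
  have e := ofReal_integral_eq_lintegral_ofReal (μ := volume.restrict (Ioc (-(π / 2)) (π / 2)))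
    (f := fun θ : ℝ => sin θ ^ 2)
    ((by fun_prop : Continuous fun θ : ℝ => sin θ ^ 2).intervalIntegrable (-(π / 2)) (π / 2)).1
    (Eventually.of_forall fun θ => sq_nonneg (sin θ))
  rw [intervalIntegral.integral_of_le neg_pi_div_two_le] at houter
  rw [houter] at e
  rw [e, ← restrict_Ioo_eq_restrict_Ioc]
  refine setLIntegral_congr_fun measurableSet_Ioo fun θ hθ => ?_
  obtain ⟨h1, h2⟩ := integral_axialStep_sq hθ
  rw [intervalIntegral.integral_of_le neg_pi_div_two_le] at h2
  have hc := cos_pos_of_mem_Ioo hθ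
  rw [restrict_Ioo_eq_restrict_Ioc, ← ofReal_integral_eq_lintegral_ofReal h1.1
    (Eventually.of_forall fun φ => sq_nonneg (axialStep (θ, φ))), h2, ← ENNReal.ofReal_mul (by positivity),
    ← ENNReal.ofReal_mul (by positivity)]
  congr 1
  field_simp

theorem integral_axialStep_sq_angleLaw :
    Integrable (fun e => axialStep e ^ 2) angleLaw ∧ ∫ e, axialStep e ^ 2 ∂angleLaw = π / 2 := by
  have hm : AEStronglyMeasurable (fun e => axialStep e ^ 2) angleLaw :=
    (measurable_axialStep.pow_const 2).aestronglyMeasurable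
  have h0 : 0 ≤ᵐ[angleLaw] fun e => axialStep e ^ 2 := Eventually.of_forall fun e => sq_nonneg _
  constructor
  · refine ⟨hm, ?_⟩
    rw [hasFiniteIntegral_iff_ofReal h0, lintegral_axialStep_sq]
    exact ENNReal.ofReal_lt_top
  · rw [integral_eq_lintegral_of_nonneg_ae h0 hm, lintegral_axialStep_sq,
      ENNReal.toReal_ofReal (by positivity)]

end StepMoments
end CylinderLight

namespace CylinderLight

/-! ### The joint law of the angle sequence. -/

section Law
open Set
open scoped ENNReal

theorem map_infinitePi_bool :
    (Measure.infinitePi fun b : Bool => if b then uniformLaw else lambertianLaw).map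
      (fun f => (f false, f true)) = angleLaw := by
  have hinst : ∀ b : Bool, IsProbabilityMeasure (if b then uniformLaw else lambertianLaw) := by
    intro b; cases b <;> simp <;> infer_instance
  refine (Measure.prod_eq fun s t hs ht => ?_).symm
  rw [Measure.map_apply (by fun_prop) (hs.prod ht)]
  have : (fun f : Bool → ℝ => (f false, f true)) ⁻¹' s ×ˢ t =
      Set.pi (Finset.univ : Finset Bool) (fun b => if b then t else s) := by
    ext f; simp [and_comm]
  rw [this, Measure.infinitePi_pi _ (fun b _ => by cases b <;> simpa)]
  simp [mul_comm]

/-- The pairs of angles form an i.i.d. sequence with law `angleLaw`. -/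
theorem map_angles {Ω : Type*} [MeasurableSpace Ω] (P : Measure Ω)
    (Θ Φ : ℕ → Ω → ℝ)
    (hΘ_meas : ∀ k, Measurable (Θ k)) (hΦ_meas : ∀ k, Measurable (Φ k))
    (hΘ_law : ∀ k, P.map (Θ k) = lambertianLaw) (hΦ_law : ∀ k, P.map (Φ k) = uniformLaw)
    (h_indep : iIndepFun (Sum.elim Θ Φ : ℕ ⊕ ℕ → Ω → ℝ) P) :
    P.map (fun ω k => (Θ k ω, Φ k ω)) = iidLaw angleLaw := by
  have hinst : ∀ b : Bool, IsProbabilityMeasure (if b then uniformLaw else lambertianLaw) := by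
    intro b; cases b <;> simp <;> infer_instance
  -- Reindexing by (step, which angle) lets the single product law be curried into a product over
  -- steps of two-coordinate laws, each identified with `angleLaw`.
  set e : ℕ × Bool → ℕ ⊕ ℕ := fun p => if p.2 then Sum.inr p.1 else Sum.inl p.1 with he
  have hinj : Function.Injective e := by
    rintro ⟨a, b⟩ ⟨c, d⟩ h
    cases b <;> cases d <;> simp_all
  set X : ℕ × Bool → Ω → ℝ := fun p => Sum.elim Θ Φ (e p) with hX
  have hXm : ∀ p, Measurable (X p) := by
    rintro ⟨k, b⟩
    cases b <;> simp [hX, he, hΘ_meas, hΦ_meas]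
  have hXlaw : ∀ p : ℕ × Bool, P.map (X p) = if p.2 then uniformLaw else lambertianLaw := by
    rintro ⟨k, b⟩
    cases b <;> simp [hX, he, hΘ_law, hΦ_law]
  have h1 : P.map (fun ω p => X p ω) =
      Measure.infinitePi fun p : ℕ × Bool => if p.2 then uniformLaw else lambertianLaw := by
    rw [(h_indep.precomp hinj).map_fun_eq_infinitePi_map hXm]
    exact congrArg _ (funext hXlaw)
  have h2 := Measure.infinitePi_map_curry
    (fun (_ : ℕ) (b : Bool) => if b then uniformLaw else lambertianLaw)
  have h3 := Measure.infinitePi_map_pi (fun _ : ℕ => Measure.infinitePi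
    fun b : Bool => if b then uniformLaw else lambertianLaw)
    (f := fun _ f => (f false, f true)) (fun _ => by fun_prop)
  simp only [map_infinitePi_bool] at h3
  refine Eq.trans ?_ h3
  have hcurry := (MeasurableEquiv.curry ℕ Bool ℝ).measurable
  rw [← h2, ← h1, Measure.map_map hcurry (measurable_pi_lambda _ hXm),
    Measure.map_map (by fun_prop) (hcurry.comp (measurable_pi_lambda _ hXm))]
  rfl

end Law
end CylinderLight

namespace CylinderLight

/-! ### Geometry of the crossing chord. -/

section Exit
open Set Real
open scoped ENNReal

/-- This says that the far end of the chord lies on the cylinder again. If the denominator vanishes,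
division by zero makes the length zero and the identity survives, so no angles need to be excluded.
-/
theorem chordLength_sq (θ φ : ℝ) :
    chordLength θ φ ^ 2 * (sin φ ^ 2 * sin θ ^ 2 + cos θ ^ 2) = 2 * chordLength θ φ * cos θ := by
  unfold chordLength
  by_cases h : sin φ ^ 2 * sin θ ^ 2 + cos θ ^ 2 = 0
  · simp [h]
  · field_simp

theorem chordLength_mul_cos_le (θ φ : ℝ) : 2 * chordLength θ φ * cos θ ≤ 4 := by
  have e : 2 * chordLength θ φ * cos θ =
      4 * (cos θ ^ 2 / (sin φ ^ 2 * sin θ ^ 2 + cos θ ^ 2)) := by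
    unfold chordLength; ring
  have : cos θ ^ 2 / (sin φ ^ 2 * sin θ ^ 2 + cos θ ^ 2) ≤ 1 :=
    div_le_one_of_le₀ (le_add_of_nonneg_left (by positivity)) (by positivity)
  rw [e]
  linarith

/-- The squared distance to the axis along a chord is quadratic in the fraction `l` and equals one
at both ends. Its coefficients involve the angles only, not the position of the reflection point on
the circle. -/
theorem normSq_chord_point (θ φ l : ℝ) {p : ℝ × ℝ × ℝ} (hp : p.2.1 ^ 2 + p.2.2 ^ 2 = 1) :
    (l * ((nextPoint θ φ p).2.1 - p.2.1) + p.2.1) ^ 2 +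
      (l * ((nextPoint θ φ p).2.2 - p.2.2) + p.2.2) ^ 2 =
    1 - 2 * chordLength θ φ * cos θ * (l * (1 - l)) := by
  have h := chordLength_sq θ φ
  simp only [nextPoint]
  linear_combination (l ^ 2 * (chordLength θ φ ^ 2 * (sin φ ^ 2 * sin θ ^ 2 + cos θ ^ 2)) -
    2 * l * chordLength θ φ * cos θ + 1) * hp + l ^ 2 * h

variable {Ω : Type*}

/-- The sequence of pairs of angles. -/
def angles (Θ Φ : ℕ → Ω → ℝ) (ω : Ω) : ℕ → ℝ × ℝ := fun k => (Θ k ω, Φ k ω)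

variable (Θ Φ : ℕ → Ω → ℝ)

theorem walkX_eq (n : ℕ) (ω : Ω) : walkX Θ Φ n ω = pathSum axialStep n (angles Θ Φ ω) := by
  induction n with
  | zero => simp [walkX, walk, pathSum_zero]
  | succ n ih =>
    rw [pathSum_succ, ← ih]
    rfl

theorem walk_normSq (n : ℕ) (ω : Ω) :
    (walk Θ Φ n ω).2.1 ^ 2 + (walk Θ Φ n ω).2.2 ^ 2 = 1 := by
  induction n with
  | zero => simp [walk]
  | succ n ih =>
    have := normSq_chord_point (Θ n ω) (Φ n ω) 1 ih
    simp only [one_mul, sub_add_cancel, sub_self, mul_zero, sub_zero] at this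
    exact this

variable {Θ Φ}

theorem passageTime_eq {s : ℝ} {ω : Ω} {n : ℕ}
    (h1 : ∀ i ≤ n, pathSum axialStep i (angles Θ Φ ω) ≤ s)
    (h2 : s < pathSum axialStep (n + 1) (angles Θ Φ ω)) : passageTime Θ Φ s ω = n + 1 := by
  have hmem : n + 1 ∈ {n : ℕ | 0 < n ∧ s < walkX Θ Φ n ω} :=
    ⟨n.succ_pos, by rwa [walkX_eq]⟩
  refine le_antisymm (Nat.sInf_le hmem) (le_csInf ⟨_, hmem⟩ fun m hm => ?_)
  by_contra h
  have := hm.2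
  rw [walkX_eq] at this
  exact absurd this (not_lt.2 (h1 m (by omega)))

/-- The pairs of a distance `u` and angles `e` for which the point at axial distance `u` on the
chord with angles `e` lies at distance at most `r` from the axis. -/
def nearAxisSet (r : ℝ) : Set (ℝ × (ℝ × ℝ)) :=
  {p | 1 - r ^ 2 ≤ 2 * chordLength p.2.1 p.2.2 * cos p.2.1 *
    (p.1 / axialStep p.2 * (1 - p.1 / axialStep p.2))}

theorem measurableSet_nearAxisSet (r : ℝ) : MeasurableSet (nearAxisSet r) := by
  have h1 : Measurable fun p : ℝ × (ℝ × ℝ) => axialStep p.2 :=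
    measurable_axialStep.comp measurable_snd
  refine measurableSet_le measurable_const ?_
  unfold chordLength
  fun_prop

/-- By rotational invariance the transverse coordinates of the walk drop out: the remaining
condition concerns the undershoot and the angles of the crossing step, which is the form handled by
`exitSet`. -/
theorem exitPoint_mem_iff {s r : ℝ} (hr : r ∈ Ioo (0 : ℝ) 1) {ω : Ω} {n : ℕ}
    (h1 : ∀ i ≤ n, pathSum axialStep i (angles Θ Φ ω) ≤ s)
    (h2 : s < pathSum axialStep (n + 1) (angles Θ Φ ω)) :
    exitPoint Θ Φ s ω ∈ openingBall r ↔
      (s - pathSum axialStep n (angles Θ Φ ω), angles Θ Φ ω n) ∈ nearAxisSet r := by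
  have hN := passageTime_eq h1 h2
  have hl : exitFraction Θ Φ s ω =
      (s - pathSum axialStep n (angles Θ Φ ω)) / axialStep (angles Θ Φ ω n) := by
    rw [exitFraction, hN, Nat.add_sub_cancel, walkX_eq, walkX_eq, pathSum_succ, add_sub_cancel_left]
  have hnorm := normSq_chord_point (Θ n ω) (Φ n ω) (exitFraction Θ Φ s ω) (walk_normSq Θ Φ n ω)
  have hY : (exitPoint Θ Φ s ω).2.1 ^ 2 + (exitPoint Θ Φ s ω).2.2 ^ 2 =
      1 - 2 * chordLength (Θ n ω) (Φ n ω) * cos (Θ n ω) *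
        (exitFraction Θ Φ s ω * (1 - exitFraction Θ Φ s ω)) := by
    rw [← hnorm]
    simp only [exitPoint, hN, Nat.add_sub_cancel]
    rfl
  have hr1 : r ^ 2 ≤ 1 := by nlinarith [hr.1, hr.2]
  simp only [openingBall, opening, nearAxisSet, mem_ofPred_eq, hY, ← hl]
  constructor
  · rintro ⟨-, h⟩
    simp only [angles]
    linarith
  · intro h
    simp only [angles] at h
    exact ⟨⟨by linarith, rfl⟩, by linarith⟩

theorem mem_hitSet_iff {ω : Ω} {n : ℕ} (h : angles Θ Φ ω ∈ hitSet axialStep n) :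
    overshoot Θ Φ 0 ω = pathSum axialStep (n + 1) (angles Θ Φ ω) ∧
      undershoot Θ Φ 0 ω = -pathSum axialStep n (angles Θ Φ ω) := by
  have hN := passageTime_eq h.1 h.2
  constructor
  · rw [overshoot, hN, walkX_eq, sub_zero]
  · rw [undershoot, hN, Nat.add_sub_cancel, walkX_eq, zero_sub]

/-- The interval of levels at which the chord from `-u` to `-u + w` is near the axis. -/
theorem volume_nearAxis_le {r : ℝ} (hr : r ∈ Ioo (0 : ℝ) 1) {n : ℕ} {x : ℕ → ℝ × ℝ}
    (hx : x ∈ hitSet axialStep n) :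
    volume {s : ℝ | 0 ≤ s ∧ s < pathSum axialStep (n + 1) x ∧
      (s - pathSum axialStep n x, x n) ∈ nearAxisSet r} ≤
    ENNReal.ofReal
      (max ((1 + r) / 2 * (-pathSum axialStep n x + pathSum axialStep (n + 1) x) -
          -pathSum axialStep n x) 0 -
        max ((1 - r) / 2 * (-pathSum axialStep n x + pathSum axialStep (n + 1) x) -
          -pathSum axialStep n x) 0) := by
  have hu : pathSum axialStep n x ≤ 0 := hx.1 n le_rfl
  have hpos : 0 < pathSum axialStep (n + 1) x := hx.2
  have hW : axialStep (x n) = -pathSum axialStep n x + pathSum axialStep (n + 1) x := by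
    rw [pathSum_succ]; ring
  set u := -pathSum axialStep n x
  set W := u + pathSum axialStep (n + 1) x
  have hWpos : 0 < W := by linarith
  have hsub : {s : ℝ | 0 ≤ s ∧ s < pathSum axialStep (n + 1) x ∧
      (s - pathSum axialStep n x, x n) ∈ nearAxisSet r} ⊆
      Icc (max ((1 - r) / 2 * W - u) 0) ((1 + r) / 2 * W - u) := by
    rintro s ⟨h0, h1, h2⟩
    simp only [nearAxisSet, mem_ofPred_eq, hW] at h2
    set l := (s - pathSum axialStep n x) / W with hl
    have hlW : l * W = s + u := by rw [hl, div_mul_cancel₀ _ hWpos.ne']; ring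
    have hl0 : 0 ≤ l := div_nonneg (by linarith) hWpos.le
    have hl1 : l ≤ 1 := (div_le_one hWpos).2 (by linarith)
    have hc := chordLength_mul_cos_le (x n).1 (x n).2
    have hq : 1 - r ^ 2 ≤ 4 * (l * (1 - l)) :=
      h2.trans (mul_le_mul_of_nonneg_right hc (mul_nonneg hl0 (by linarith)))
    -- From $(2l-1)^2=1-4l(1-l)\le r^2$: the level lies in the middle part of the chord, between the
    -- fractions $(1-r)/2$ and $(1+r)/2$.
    have habs : |2 * l - 1| ≤ r := abs_le_of_sq_le_sq (by nlinarith) hr.1.le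
    obtain ⟨ha, hb⟩ := abs_le.1 habs
    refine ⟨max_le ?_ h0, ?_⟩ <;> nlinarith
  refine (measure_mono hsub).trans ?_
  rw [Real.volume_Icc]
  exact ENNReal.ofReal_le_ofReal (sub_le_sub_right (le_max_left _ _) _)

end Exit
end CylinderLight

namespace CylinderLight

/-! ### Transfer to the probability space, the limit and its bounds. -/

section Limit
open Set Real
open scoped ENNReal

instance isProbabilityMeasure_ladderLaw : IsProbabilityMeasure (hitMeasure angleLaw axialStep 1) :=
  isProbabilityMeasure_hitMeasure angleLaw measurable_axialStep conj_charFun_axialStep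
    map_axialStep_singleton

theorem lintegral_ladderLaw_le :
    ∫⁻ y, ENNReal.ofReal y ∂(hitMeasure angleLaw axialStep 1) ≤ ENNReal.ofReal (√π / 2) := by
  refine (lintegral_hitMeasure_le angleLaw measurable_axialStep conj_charFun_axialStep
    map_axialStep_singleton integral_axialStep_sq_angleLaw.1
    integral_axialStep_sq_angleLaw.2.le).trans (le_of_eq ?_)
  congr 1
  rw [show π / 2 / 2 = π / 2 ^ 2 by ring, sqrt_div pi_pos.le, sqrt_sq zero_le_two]

variable {Ω : Type*} [MeasurableSpace Ω] {P : Measure Ω} {Θ Φ : ℕ → Ω → ℝ}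

theorem ae_exists_hitSet (hX : Measurable (angles Θ Φ))
    (hlaw : P.map (angles Θ Φ) = iidLaw angleLaw) :
    ∀ᵐ ω ∂P, ω ∈ ⋃ n, angles Θ Φ ⁻¹' hitSet axialStep n := by
  rw [← preimage_iUnion]
  refine ae_of_ae_map hX.aemeasurable (p := fun x => x ∈ ⋃ n, hitSet axialStep n) ?_
  rw [hlaw]
  exact (mem_ae_iff_prob_eq_one (MeasurableSet.iUnion (measurableSet_hitSet
    measurable_axialStep))).2 (measure_iUnion_hitSet angleLaw measurable_axialStep)

theorem ae_exists_lt_walkX (hX : Measurable (angles Θ Φ))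
    (hlaw : P.map (angles Θ Φ) = iidLaw angleLaw) {s : ℝ} (hs : 0 ≤ s) :
    ∀ᵐ ω ∂P, angles Θ Φ ω ∈ exitSet axialStep univ s := by
  refine ae_of_ae_map hX.aemeasurable (p := fun x => x ∈ exitSet axialStep univ s) ?_
  rw [hlaw]
  exact ae_mem_exitSet_univ angleLaw measurable_axialStep
    (ne_top_of_le_ne_top ENNReal.ofReal_ne_top lintegral_ladderLaw_le)
    exists_smul_restrict_le_map_axialStep hs

/-- The passage time is an infimum, so functions of it are handled piecewise: the events `hitSet`
exhaust the space almost surely, and on each the function is explicit. The default value `0` of the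
infimum matters only on a null set. -/
theorem aemeasurable_of_hitSet (hX : Measurable (angles Θ Φ))
    (hlaw : P.map (angles Θ Φ) = iidLaw angleLaw) {F : Ω → ℝ} {f : ℕ → (ℕ → ℝ × ℝ) → ℝ}
    (hf : ∀ n, Measurable (f n))
    (hF : ∀ n ω, angles Θ Φ ω ∈ hitSet axialStep n → F ω = f n (angles Θ Φ ω)) :
    AEMeasurable F P := by
  rw [← Measure.restrict_eq_self_of_ae_mem (ae_exists_hitSet hX hlaw), aemeasurable_iUnion_iff]
  intro n
  refine ((hf n).comp hX).aemeasurable.congr ?_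
  refine (ae_restrict_iff' (hX (measurableSet_hitSet measurable_axialStep n))).2
    (Eventually.of_forall fun ω hω => (hF n ω hω).symm)

theorem lintegral_of_hitSet (hX : Measurable (angles Θ Φ))
    (hlaw : P.map (angles Θ Φ) = iidLaw angleLaw) {F : Ω → ℝ≥0∞} {f : ℕ → (ℕ → ℝ × ℝ) → ℝ≥0∞}
    (hf : ∀ n, Measurable (f n))
    (hF : ∀ n ω, angles Θ Φ ω ∈ hitSet axialStep n → F ω = f n (angles Θ Φ ω)) :
    ∫⁻ ω, F ω ∂P = ∑' n, ∫⁻ x in hitSet axialStep n, f n x ∂(iidLaw angleLaw) := by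
  have hm := fun n => measurableSet_hitSet measurable_axialStep n
  conv_lhs => rw [← Measure.restrict_eq_self_of_ae_mem (ae_exists_hitSet hX hlaw)]
  rw [lintegral_iUnion (fun n => hX (hm n))
    (fun m n hmn => (disjoint_hitSet axialStep hmn).preimage _)]
  refine tsum_congr fun n => ?_
  rw [← hlaw, setLIntegral_map (hm n) (hf n) hX]
  exact setLIntegral_congr_fun (hX (hm n)) fun ω hω => hF n ω hω

theorem aemeasurable_overshoot (hX : Measurable (angles Θ Φ))
    (hlaw : P.map (angles Θ Φ) = iidLaw angleLaw) : AEMeasurable (overshoot Θ Φ 0) P :=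
  aemeasurable_of_hitSet hX hlaw (fun n => measurable_pathSum measurable_axialStep (n + 1))
    fun _ _ hω => (mem_hitSet_iff hω).1

theorem lintegral_overshoot (hX : Measurable (angles Θ Φ))
    (hlaw : P.map (angles Θ Φ) = iidLaw angleLaw) :
    ∫⁻ ω, ENNReal.ofReal (overshoot Θ Φ 0 ω) ∂P =
      ∫⁻ y, ENNReal.ofReal y ∂(hitMeasure angleLaw axialStep 1) := by
  have hS := measurable_pathSum measurable_axialStep
  rw [lintegral_of_hitSet hX hlaw (f := fun n x => ENNReal.ofReal (pathSum axialStep (n + 1) x))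
    (fun n => (hS (n + 1)).ennreal_ofReal) fun n ω hω => by rw [(mem_hitSet_iff hω).1],
    lintegral_hitMeasure_one]
  refine tsum_congr fun n => ?_
  rw [hitLaw, lintegral_map ENNReal.measurable_ofReal (hS (n + 1))]

theorem ae_overshoot_pos (hX : Measurable (angles Θ Φ))
    (hlaw : P.map (angles Θ Φ) = iidLaw angleLaw) :
    ∀ᵐ ω ∂P, 0 < overshoot Θ Φ 0 ω ∧ 0 ≤ undershoot Θ Φ 0 ω := by
  filter_upwards [ae_exists_hitSet hX hlaw] with ω hω
  obtain ⟨n, hn⟩ := mem_iUnion.1 hω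
  obtain ⟨h1, h2⟩ := mem_hitSet_iff hn
  rw [h1, h2]
  exact ⟨hn.2, neg_nonneg.2 (hn.1 n le_rfl)⟩

theorem integrable_overshoot [IsProbabilityMeasure P] (hX : Measurable (angles Θ Φ))
    (hlaw : P.map (angles Θ Φ) = iidLaw angleLaw) : Integrable (overshoot Θ Φ 0) P := by
  refine ⟨(aemeasurable_overshoot hX hlaw).aestronglyMeasurable, ?_⟩
  rw [hasFiniteIntegral_iff_ofReal ((ae_overshoot_pos hX hlaw).mono fun ω h => h.1.le),
    lintegral_overshoot hX hlaw]
  exact lintegral_ladderLaw_le.trans_lt ENNReal.ofReal_lt_top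

theorem integral_overshoot [IsProbabilityMeasure P] (hX : Measurable (angles Θ Φ))
    (hlaw : P.map (angles Θ Φ) = iidLaw angleLaw) :
    ∫ ω, overshoot Θ Φ 0 ω ∂P =
      (∫⁻ y, ENNReal.ofReal y ∂(hitMeasure angleLaw axialStep 1)).toReal := by
  rw [integral_eq_lintegral_of_nonneg_ae ((ae_overshoot_pos hX hlaw).mono fun ω h => h.1.le)
    (aemeasurable_overshoot hX hlaw).aestronglyMeasurable, lintegral_overshoot hX hlaw]

theorem integral_overshoot_pos [IsProbabilityMeasure P] (hX : Measurable (angles Θ Φ))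
    (hlaw : P.map (angles Θ Φ) = iidLaw angleLaw) : 0 < ∫ ω, overshoot Θ Φ 0 ω ∂P := by
  rw [integral_overshoot hX hlaw]
  exact ENNReal.toReal_pos
    (lintegral_ofReal_ne_zero (hitMeasure_Iic angleLaw measurable_axialStep 1))
    (ne_top_of_le_ne_top ENNReal.ofReal_ne_top lintegral_ladderLaw_le)

/-- `gammaIntegrand` on the paths with first ladder epoch `n + 1`. -/
noncomputable def pathGamma (t : ℝ) (n : ℕ) (x : ℕ → ℝ × ℝ) : ℝ :=
  max (t * (-pathSum axialStep n x + pathSum axialStep (n + 1) x) - -pathSum axialStep n x) 0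

theorem measurable_pathGamma (t : ℝ) (n : ℕ) : Measurable (pathGamma t n) := by
  have hS := measurable_pathSum measurable_axialStep
  exact ((((hS n).neg.add (hS (n + 1))).const_mul t).sub (hS n).neg).max measurable_const

theorem gammaIntegrand_eq {Ω : Type*} {Θ Φ : ℕ → Ω → ℝ} {t : ℝ} {n : ℕ} {ω : Ω}
    (h : angles Θ Φ ω ∈ hitSet axialStep n) :
    gammaIntegrand Θ Φ t ω = pathGamma t n (angles Θ Φ ω) := by
  rw [gammaIntegrand, (mem_hitSet_iff h).1, (mem_hitSet_iff h).2, pathGamma]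

/-- Almost surely $U_0\ge0$, and $t\le1$ gives $tU_0-U_0\le0$. This yields both integrability and
the upper bound $\Gamma(t)\le t$. -/
theorem ae_gammaIntegrand_le (hX : Measurable (angles Θ Φ))
    (hlaw : P.map (angles Θ Φ) = iidLaw angleLaw) {t : ℝ} (ht : t ∈ Icc (0 : ℝ) 1) :
    ∀ᵐ ω ∂P, gammaIntegrand Θ Φ t ω ≤ t * overshoot Θ Φ 0 ω := by
  filter_upwards [ae_overshoot_pos hX hlaw] with ω hω
  refine max_le ?_ (mul_nonneg ht.1 hω.1.le)
  nlinarith [hω.2, ht.2]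

theorem integrable_gammaIntegrand [IsProbabilityMeasure P] (hX : Measurable (angles Θ Φ))
    (hlaw : P.map (angles Θ Φ) = iidLaw angleLaw) {t : ℝ} (ht : t ∈ Icc (0 : ℝ) 1) :
    Integrable (gammaIntegrand Θ Φ t) P := by
  refine ((integrable_overshoot hX hlaw).const_mul t).mono' (aemeasurable_of_hitSet hX hlaw
    (measurable_pathGamma t) fun _ _ h => gammaIntegrand_eq h).aestronglyMeasurable ?_
  filter_upwards [ae_gammaIntegrand_le hX hlaw ht] with ω hω
  rwa [Real.norm_eq_abs, abs_of_nonneg (le_max_right _ _)]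

/-- If the first step is positive then $U_0=0$ and $O_0=X_1$, so the integrand is $tX_1$. All later
ladder epochs contribute nonnegative amounts and are discarded. -/
theorem mul_le_integral_gammaIntegrand [IsProbabilityMeasure P] (hX : Measurable (angles Θ Φ))
    (hlaw : P.map (angles Θ Φ) = iidLaw angleLaw) {t : ℝ} (ht : t ∈ Icc (0 : ℝ) 1) :
    t * (1 - 2 / π) ≤ ∫ ω, gammaIntegrand Θ Φ t ω ∂P := by
  have hmeas : Measurable fun x : ℕ → ℝ × ℝ => ENNReal.ofReal (axialStep (x 0)) :=
    (measurable_axialStep.comp (measurable_pi_apply 0)).ennreal_ofReal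
  have h1 : ENNReal.ofReal (t * (1 - 2 / π)) ≤
      ∫⁻ ω, ENNReal.ofReal (gammaIntegrand Θ Φ t ω) ∂P := by
    calc ENNReal.ofReal (t * (1 - 2 / π))
        = ENNReal.ofReal t * ENNReal.ofReal (1 - 2 / π) := ENNReal.ofReal_mul ht.1
      _ ≤ ENNReal.ofReal t * ∫⁻ e, ENNReal.ofReal (axialStep e) ∂angleLaw := by
          gcongr; exact ofReal_le_lintegral_axialStep
      _ = ENNReal.ofReal t * ∫⁻ x, ENNReal.ofReal (axialStep (x 0)) ∂(iidLaw angleLaw) := by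
          congr 1
          exact ((measurePreserving_eval_infinitePi (fun _ : ℕ => angleLaw) 0).lintegral_comp
            measurable_axialStep.ennreal_ofReal).symm
      _ = ∫⁻ x, ENNReal.ofReal t * ENNReal.ofReal (axialStep (x 0)) ∂(iidLaw angleLaw) :=
          (lintegral_const_mul _ hmeas).symm
      _ ≤ ∫⁻ x in hitSet axialStep 0, ENNReal.ofReal (pathGamma t 0 x) ∂(iidLaw angleLaw) := by
          rw [← lintegral_indicator (measurableSet_hitSet measurable_axialStep 0)]
          refine lintegral_mono fun x => ?_
          by_cases hx : x ∈ hitSet axialStep 0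
          · rw [indicator_of_mem hx, ← ENNReal.ofReal_mul ht.1]
            refine ENNReal.ofReal_le_ofReal (le_trans (le_of_eq ?_) (le_max_left _ _))
            rw [pathSum_succ, pathSum_zero]
            ring
          · have : axialStep (x 0) ≤ 0 := by
              by_contra h
              refine hx ⟨by rw [staySet_zero]; trivial, ?_⟩
              show 0 < pathSum axialStep (0 + 1) x
              rw [pathSum_succ, pathSum_zero, zero_add]
              exact not_le.1 h
            rw [ENNReal.ofReal_of_nonpos this, mul_zero]
            exact zero_le
      _ ≤ ∑' n, ∫⁻ x in hitSet axialStep n, ENNReal.ofReal (pathGamma t n x) ∂(iidLaw angleLaw) :=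
          ENNReal.le_tsum 0
      _ = ∫⁻ ω, ENNReal.ofReal (gammaIntegrand Θ Φ t ω) ∂P :=
          (lintegral_of_hitSet hX hlaw (fun n => (measurable_pathGamma t n).ennreal_ofReal)
            fun n ω hω => by rw [gammaIntegrand_eq hω]).symm
  rw [← ofReal_integral_eq_lintegral_ofReal (integrable_gammaIntegrand hX hlaw ht)
    (Eventually.of_forall fun ω => le_max_right _ _)] at h1
  exact (ENNReal.ofReal_le_ofReal_iff (integral_nonneg fun ω => le_max_right _ _)).1 h1

theorem measure_exitPoint_eq (hX : Measurable (angles Θ Φ))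
    (hlaw : P.map (angles Θ Φ) = iidLaw angleLaw) {r : ℝ} (hr : r ∈ Ioo (0 : ℝ) 1) {s : ℝ}
    (hs : 0 ≤ s) :
    P {ω | exitPoint Θ Φ s ω ∈ openingBall r} =
      iidLaw angleLaw (exitSet axialStep (nearAxisSet r) s) := by
  have hmeas : MeasurableSet (exitSet axialStep (nearAxisSet r) s) :=
    measurable_prodMk_left (measurableSet_exitSet measurable_axialStep (measurableSet_nearAxisSet r))
  rw [← hlaw, Measure.map_apply hX hmeas]
  refine measure_congr ?_
  filter_upwards [ae_exists_lt_walkX hX hlaw hs] with ω hω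
  obtain ⟨n, h1, h2, -⟩ := hω
  refine propext ⟨fun h => ⟨n, h1, h2, (exitPoint_mem_iff hr h1 h2).1 h⟩, ?_⟩
  rintro ⟨m, h3, h4, h5⟩
  exact (exitPoint_mem_iff hr h3 h4).2 h5

/-- Tonelli turns the integral over levels into the expected length of the near-axis levels on the
first ladder chord, which `volume_nearAxis_le` bounds path by path. -/
theorem lintegral_ladderExitProb_nearAxisSet_le [IsProbabilityMeasure P] (hX : Measurable (angles Θ Φ))
    (hlaw : P.map (angles Θ Φ) = iidLaw angleLaw) {r : ℝ} (hr : r ∈ Ioo (0 : ℝ) 1) :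
    ∫⁻ s in Ici 0, ladderExitProb angleLaw axialStep (nearAxisSet r) s ≤
      ENNReal.ofReal ((∫ ω, gammaIntegrand Θ Φ ((1 + r) / 2) ω ∂P) -
        ∫ ω, gammaIntegrand Θ Φ ((1 - r) / 2) ω ∂P) := by
  have i1 := integrable_gammaIntegrand hX hlaw (t := (1 + r) / 2)
    ⟨by linarith [hr.1], by linarith [hr.2]⟩
  have i2 := integrable_gammaIntegrand hX hlaw (t := (1 - r) / 2)
    ⟨by linarith [hr.2], by linarith [hr.1]⟩
  have i3 : Integrable (fun ω => gammaIntegrand Θ Φ ((1 + r) / 2) ω -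
      gammaIntegrand Θ Φ ((1 - r) / 2) ω) P := i1.sub i2
  have hmono : ∀ᵐ ω ∂P, 0 ≤ gammaIntegrand Θ Φ ((1 + r) / 2) ω -
      gammaIntegrand Θ Φ ((1 - r) / 2) ω := by
    filter_upwards [ae_overshoot_pos hX hlaw] with ω hω
    refine sub_nonneg.2 (max_le_max (sub_le_sub_right (mul_le_mul_of_nonneg_right ?_ ?_) _) le_rfl)
    · linarith [hr.1]
    · linarith [hω.1, hω.2]
  rw [lintegral_ladderExitProb angleLaw measurable_axialStep (measurableSet_nearAxisSet r),
    ← integral_sub i1 i2, ofReal_integral_eq_lintegral_ofReal i3 hmono,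
    lintegral_of_hitSet hX hlaw
      (f := fun n x => ENNReal.ofReal (pathGamma ((1 + r) / 2) n x - pathGamma ((1 - r) / 2) n x))
      (fun n => ((measurable_pathGamma _ n).sub (measurable_pathGamma _ n)).ennreal_ofReal)
      fun n ω hω => by rw [gammaIntegrand_eq hω, gammaIntegrand_eq hω]]
  exact ENNReal.tsum_le_tsum fun n => setLIntegral_mono'
    (measurableSet_hitSet measurable_axialStep n) fun x hx => volume_nearAxis_le hr hx

theorem exists_tendsto_exitPoint [IsProbabilityMeasure P] (hX : Measurable (angles Θ Φ))
    (hlaw : P.map (angles Θ Φ) = iidLaw angleLaw) {r : ℝ} (hr : r ∈ Ioo (0 : ℝ) 1) :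
    ∃ L : ℝ, Tendsto (fun s : ℝ => P.real {ω | exitPoint Θ Φ s ω ∈ openingBall r}) atTop (𝓝 L) ∧
      L ≤ limitGamma P Θ Φ ((1 + r) / 2) - limitGamma P Θ Φ ((1 - r) / 2) := by
  have hpos := hitMeasure_Iic angleLaw measurable_axialStep 1
  have hne := lintegral_ofReal_ne_zero hpos
  have htop : ∫⁻ y, ENNReal.ofReal y ∂(hitMeasure angleLaw axialStep 1) ≠ ⊤ :=
    ne_top_of_le_ne_top ENNReal.ofReal_ne_top lintegral_ladderLaw_le
  have hlim := tendsto_exitProb angleLaw measurable_axialStep htop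
    exists_smul_restrict_le_map_axialStep (measurableSet_nearAxisSet r)
  have hle := lintegral_ladderExitProb_nearAxisSet_le hX hlaw hr
  have hκ : ∫⁻ s in Ici 0, ladderExitProb angleLaw axialStep (nearAxisSet r) s ≠ ⊤ :=
    ne_top_of_le_ne_top ENNReal.ofReal_ne_top hle
  refine ⟨_, ((ENNReal.tendsto_toReal (ENNReal.div_ne_top hκ hne)).comp hlim).congr' ?_, ?_⟩
  · filter_upwards [eventually_ge_atTop 0] with s hs
    simp only [Function.comp, measureReal_def, measure_exitPoint_eq hX hlaw hr hs]
  · have hdiff : 0 ≤ (∫ ω, gammaIntegrand Θ Φ ((1 + r) / 2) ω ∂P) -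
        ∫ ω, gammaIntegrand Θ Φ ((1 - r) / 2) ω ∂P := by
      rw [sub_nonneg]
      refine integral_mono_ae
        (integrable_gammaIntegrand hX hlaw ⟨by linarith [hr.2], by linarith [hr.1]⟩)
        (integrable_gammaIntegrand hX hlaw ⟨by linarith [hr.1], by linarith [hr.2]⟩) ?_
      filter_upwards [ae_overshoot_pos hX hlaw] with ω hω
      refine max_le_max (sub_le_sub_right (mul_le_mul_of_nonneg_right ?_ ?_) _) le_rfl
      · linarith [hr.1]
      · linarith [hω.1, hω.2]
    rw [limitGamma, limitGamma, ← sub_div, ENNReal.toReal_div, ← integral_overshoot hX hlaw]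
    exact div_le_div_of_nonneg_right (ENNReal.toReal_le_of_le_ofReal hdiff hle)
      (integral_overshoot_pos hX hlaw).le

theorem limitGamma_sub_le [IsProbabilityMeasure P] (hX : Measurable (angles Θ Φ))
    (hlaw : P.map (angles Θ Φ) = iidLaw angleLaw) {r : ℝ} (hr : r ∈ Ioo (0 : ℝ) 1) :
    limitGamma P Θ Φ ((1 + r) / 2) - limitGamma P Θ Φ ((1 - r) / 2) ≤
      (1 / 2 + π ^ (-(1 / 2) : ℝ) - 2 * π ^ (-(3 / 2) : ℝ)) * r +
        1 / 2 - π ^ (-(1 / 2) : ℝ) + 2 * π ^ (-(3 / 2) : ℝ) := by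
  have hμ := integral_overshoot_pos hX hlaw
  have ht₂ : (1 + r) / 2 ∈ Icc (0 : ℝ) 1 := ⟨by linarith [hr.1], by linarith [hr.2]⟩
  have ht₁ : (1 - r) / 2 ∈ Icc (0 : ℝ) 1 := ⟨by linarith [hr.2], by linarith [hr.1]⟩
  have hupper : limitGamma P Θ Φ ((1 + r) / 2) ≤ (1 + r) / 2 := by
    rw [limitGamma, div_le_iff₀ hμ, ← integral_const_mul]
    exact integral_mono_ae (integrable_gammaIntegrand hX hlaw ht₂)
      ((integrable_overshoot hX hlaw).const_mul _) (ae_gammaIntegrand_le hX hlaw ht₂)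
  have hμle : ∫ ω, overshoot Θ Φ 0 ω ∂P ≤ √π / 2 := by
    rw [integral_overshoot hX hlaw]
    exact ENNReal.toReal_le_of_le_ofReal (by positivity) lintegral_ladderLaw_le
  -- The lower bound on the numerator combines with the Wiener–Hopf upper bound $\sqrt\pi/2$ on the
  -- denominator; this is the source of the powers of $\pi$ in $a(r)$.
  have hlower : (1 - r) / 2 * (1 - 2 / π) / (√π / 2) ≤ limitGamma P Θ Φ ((1 - r) / 2) := by
    rw [limitGamma]
    exact div_le_div₀ (integral_nonneg fun ω => le_max_right _ _)
      (mul_le_integral_gammaIntegrand hX hlaw ht₁) hμ hμle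
  have e1 : π ^ (-(1 / 2) : ℝ) = 1 / √π := by
    rw [rpow_neg pi_pos.le, sqrt_eq_rpow, one_div (π ^ _)]
  have e2 : π ^ (-(3 / 2) : ℝ) = 1 / (π * √π) := by
    rw [rpow_neg pi_pos.le, sqrt_eq_rpow, one_div (π * _), show (3 / 2 : ℝ) = 1 + 1 / 2 by norm_num,
      rpow_add pi_pos, rpow_one]
  have e3 : (1 - r) / 2 * (1 - 2 / π) / (√π / 2) =
      (1 - r) * (1 / √π) - (1 - r) * (2 * (1 / (π * √π))) := by
    field_simp
  rw [e1, e2]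
  rw [e3] at hlower
  linarith

end Limit
end CylinderLight

theorem theorem5p7 {Ω : Type*} [MeasurableSpace Ω] (P : Measure Ω) [IsProbabilityMeasure P]
    (Θ Φ : ℕ → Ω → ℝ)
    (hΘ_meas : ∀ k, Measurable (Θ k)) (hΦ_meas : ∀ k, Measurable (Φ k))
    (hΘ_law : ∀ k, P.map (Θ k) = CylinderLight.lambertianLaw)
    (hΦ_law : ∀ k, pdf.IsUniform (Φ k) (Set.Icc (-(Real.pi / 2)) (Real.pi / 2)) P volume)
    (h_indep : iIndepFun (Sum.elim Θ Φ : ℕ ⊕ ℕ → Ω → ℝ) P) :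
    -- the ray exits almost surely, and `Γ` is given by convergent integrals
    (∀ s : ℝ, 0 ≤ s → ∀ᵐ ω ∂P, ∃ n : ℕ, 0 < n ∧ s < CylinderLight.walkX Θ Φ n ω) ∧
    Integrable (CylinderLight.overshoot Θ Φ 0) P ∧
    0 < ∫ ω, CylinderLight.overshoot Θ Φ 0 ω ∂P ∧
    (∀ t ∈ Set.Icc (0 : ℝ) 1, Integrable (CylinderLight.gammaIntegrand Θ Φ t) P) ∧
    -- the limit exists and satisfies both bounds
    ∀ r ∈ Set.Ioo (0 : ℝ) 1, ∃ L : ℝ,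
      Tendsto (fun s : ℝ =>
          P.real {ω | CylinderLight.exitPoint Θ Φ s ω ∈ CylinderLight.openingBall r})
        atTop (𝓝 L) ∧
      L ≤ CylinderLight.limitGamma P Θ Φ ((1 + r) / 2) -
          CylinderLight.limitGamma P Θ Φ ((1 - r) / 2) ∧
      L ≤ (1 / 2 + Real.pi ^ (-(1 / 2) : ℝ) - 2 * Real.pi ^ (-(3 / 2) : ℝ)) * r +
          1 / 2 - Real.pi ^ (-(1 / 2) : ℝ) + 2 * Real.pi ^ (-(3 / 2) : ℝ) := by
  have hX : Measurable (CylinderLight.angles Θ Φ) :=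
    measurable_pi_lambda _ fun k => (hΘ_meas k).prodMk (hΦ_meas k)
  have hlaw : P.map (CylinderLight.angles Θ Φ) = CylinderLight.iidLaw CylinderLight.angleLaw :=
    -- `pdf.IsUniform` unfolds to equality of the law with the conditioned Lebesgue measure, which
    -- is `uniformLaw` by definition.
    CylinderLight.map_angles P Θ Φ hΘ_meas hΦ_meas hΘ_law (fun k => hΦ_law k) h_indep
  refine ⟨fun s hs => ?_, CylinderLight.integrable_overshoot hX hlaw,
    CylinderLight.integral_overshoot_pos hX hlaw,
    fun t ht => CylinderLight.integrable_gammaIntegrand hX hlaw ht, fun r hr => ?_⟩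
  · filter_upwards [CylinderLight.ae_exists_lt_walkX hX hlaw hs] with ω hω
    obtain ⟨n, -, h, -⟩ := hω
    exact ⟨n + 1, n.succ_pos, by rwa [CylinderLight.walkX_eq]⟩
  · obtain ⟨L, h1, h2⟩ := CylinderLight.exists_tendsto_exitPoint hX hlaw hr
    exact ⟨L, h1, h2, h2.trans (CylinderLight.limitGamma_sub_le hX hlaw hr)⟩
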